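/- A monoid $M$ is *atomic* if it is generated by its atoms (an atom is an element $x\neq 1$ such that $x=yz$ implies $y=1$ or $z=1$) and if, for every $x\in M$, the lengths of the decompositions of $x$ as a product of atoms are bounded. $M$ is *Gaussian* if it is atomic, left and right cancellative, and any two elements admit a right lcm, a left lcm, a right gcd and a left gcd. A *Garside monoid* is a Gaussian monoid $M$ that contains an element $\Delta$ whose left divisors coincide with its right divisors, are finite in number, and generate $M$. A *Garside group* is a group that is the group of fractions of some Garside monoid. A finite monoid presentation consists of an integer $n\ge 0$ and a finite list of pairs of words in the letters $0,\dots,n-1$; a finite group presentation consists of an integer $n\ge 0$ and a finite list of pairs of words in the letters $0,\dots,n-1$ and their formal inverses. **Theorem.** (1) Being a Garside group is a $\Sigma^0_1$ (that is, recursively enumerable) property of finite group presentations: the set of finite group presentations $P$ such that the group presented by $P$ is a Garside group is recursively enumerable. (2) Being a Garside monoid is a $\Sigma^0_1$ property of finite monoid presentations: the set of finite monoid presentations $P$ such that the monoid presented by $P$ is a Garside monoid is recursively enumerable. (3) Consequently there is an algorithm that lists all Garside groups: there is a computable sequence of finite group presentations whose terms are exactly the finite presentations of Garside groups, and every Garside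 group is isomorphic to the group presented by some term of the sequence. (4) Likewise there is an algorithm that lists all Garside monoids: there is a computable sequence of finite monoid presentations whose terms are exactly the finite presentations of Garside monoids, and every Garside monoid is isomorphic to the monoid presented by some term of the sequence. -/

import Mathlib

universe u

namespace Garside

section Monoids

/-! In a monoid, `x ∣ y` means that `x` is a left divisor of `y` (`y = x * z` for some `z`), and
`x ∣ᵣ y` that `x` is a right divisor of `y` (`y = z * x` for some `z`). -/

variable {M : Type*} [Monoid M]

/-- `z` is a right lcm of `x` and `y`. -/
def IsRightLcm (x y z : M) : Prop :=
  x ∣ z ∧ y ∣ z ∧ ∀ w, x ∣ w → y ∣ w → z ∣ w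

/-- `z` is a left lcm of `x` and `y`. -/
def IsLeftLcm (x y z : M) : Prop :=
  x ∣ᵣ z ∧ y ∣ᵣ z ∧ ∀ w, x ∣ᵣ w → y ∣ᵣ w → z ∣ᵣ w

/-- `z` is a left gcd of `x` and `y`. -/
def IsLeftGcd (x y z : M) : Prop :=
  z ∣ x ∧ z ∣ y ∧ ∀ w, w ∣ x → w ∣ y → w ∣ z

/-- `z` is a right gcd of `x` and `y`. -/
def IsRightGcd (x y z : M) : Prop :=
  z ∣ᵣ x ∧ z ∣ᵣ y ∧ ∀ w, w ∣ᵣ x → w ∣ᵣ y → w ∣ᵣ z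

/-- `x` is an atom: `x ≠ 1`, and `x = yz` forces `y = 1` or `z = 1`. -/
def IsMonoidAtom (x : M) : Prop := x ≠ 1 ∧ ∀ y z, x = y * z → y = 1 ∨ z = 1

variable (M) in
/-- `M` is atomic: it is generated by its atoms, and for every `x` the lengths of the
decompositions of `x` as a product of atoms are bounded. -/
structure IsAtomicMonoid : Prop where
  closure_atoms : Submonoid.closure {a : M | IsMonoidAtom a} = ⊤
  norm_finite : ∀ x : M, ∃ n : ℕ, ∀ l : List M,
    (∀ a ∈ l, IsMonoidAtom a) → l.prod = x → l.length ≤ n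

variable (M) in
/-- Gaussian monoids: atomic, cancellative, with lcm's and gcd's on both sides. -/
structure IsGaussianMonoid : Prop where
  atomic : IsAtomicMonoid M
  cancel : IsCancelMul M
  right_lcm : ∀ x y : M, ∃ z, IsRightLcm x y z
  left_lcm : ∀ x y : M, ∃ z, IsLeftLcm x y z
  right_gcd : ∀ x y : M, ∃ z, IsRightGcd x y z
  left_gcd : ∀ x y : M, ∃ z, IsLeftGcd x y z

/-- `Δ` is a Garside element: its left divisors coincide with its right divisors, they are
finite in number, and they generate the monoid. -/
structure IsGarsideElement (Δ : M) : Prop where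
  left_iff_right : ∀ x, x ∣ Δ ↔ x ∣ᵣ Δ
  finite : {x : M | x ∣ Δ}.Finite
  closure_divisors : Submonoid.closure {x : M | x ∣ Δ} = ⊤

variable (M) in
/-- Garside monoids: Gaussian monoids that contain a Garside element. -/
structure IsGarsideMonoid : Prop where
  gaussian : IsGaussianMonoid M
  exists_garside : ∃ Δ : M, IsGarsideElement Δ

/-- The group `G` is, through `ι`, the group of fractions of the monoid `M`: `ι` embeds `M` in
`G`, and every element of `G` is both a left fraction and a right fraction of elements of `M`. -/
structure IsGroupOfFractions {G : Type*} [Group G] (ι : M →* G) : Prop where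
  injective : Function.Injective ι
  left_fraction : ∀ g : G, ∃ x y : M, g = (ι x)⁻¹ * ι y
  right_fraction : ∀ g : G, ∃ x y : M, g = ι x * (ι y)⁻¹

end Monoids

/-- Garside groups: the groups of fractions of Garside monoids. -/
def IsGarsideGroup (G : Type u) [Group G] : Prop :=
  ∃ (M : Type u) (_ : Monoid M) (ι : M →* G), IsGarsideMonoid M ∧ IsGroupOfFractions ι

section Presentations

/-- A list of letters all of which are `< n`. -/
def WordBelow (n : ℕ) (w : List ℕ) : Prop := ∀ a ∈ w, a < n

/-- A list of signed letters all of which are `< n`. -/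
def SignedWordBelow (n : ℕ) (w : List (ℕ × Bool)) : Prop := ∀ a ∈ w, a.1 < n

/-- `(n, R)` is a finite monoid presentation: `R` is a list of pairs of words in the letters
`0, …, n - 1`. -/
def MonoidPresentationOk (p : ℕ × List (List ℕ × List ℕ)) : Prop :=
  ∀ r ∈ p.2, WordBelow p.1 r.1 ∧ WordBelow p.1 r.2

/-- `(n, R)` is a finite group presentation: `R` is a list of pairs of words in the letters
`0, …, n - 1` and their formal inverses; `(i, true)` is the letter `i`, and `(i, false)` its
inverse. -/
def GroupPresentationOk (p : ℕ × List (List (ℕ × Bool) × List (ℕ × Bool))) : Prop :=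
  ∀ r ∈ p.2, SignedWordBelow p.1 r.1 ∧ SignedWordBelow p.1 r.2

instance (n : ℕ) (w : List ℕ) : Decidable (WordBelow n w) :=
  inferInstanceAs (Decidable (∀ a ∈ w, a < n))

instance (n : ℕ) (w : List (ℕ × Bool)) : Decidable (SignedWordBelow n w) :=
  inferInstanceAs (Decidable (∀ a ∈ w, a.1 < n))

instance : DecidablePred MonoidPresentationOk := fun p =>
  inferInstanceAs (Decidable (∀ r ∈ p.2, WordBelow p.1 r.1 ∧ WordBelow p.1 r.2))

instance : DecidablePred GroupPresentationOk := fun p =>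
  inferInstanceAs (Decidable (∀ r ∈ p.2, SignedWordBelow p.1 r.1 ∧ SignedWordBelow p.1 r.2))

theorem primrecPred_wordBelow :
    PrimrecPred fun q : List ℕ × ℕ => WordBelow q.2 q.1 :=
  PrimrecRel.forall_mem_list (R := fun a n : ℕ => a < n) Primrec.nat_lt

theorem primrecPred_signedWordBelow :
    PrimrecPred fun q : List (ℕ × Bool) × ℕ => SignedWordBelow q.2 q.1 :=
  PrimrecRel.forall_mem_list (R := fun (a : ℕ × Bool) (n : ℕ) => a.1 < n)
    (Primrec.nat_lt.comp (Primrec.fst.comp Primrec.fst) Primrec.snd)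

theorem primrecPred_monoidPresentationOk : PrimrecPred MonoidPresentationOk := by
  have h : PrimrecRel fun (r : List ℕ × List ℕ) (n : ℕ) => WordBelow n r.1 ∧ WordBelow n r.2 :=
    (primrecPred_wordBelow.comp
      (Primrec.pair (Primrec.fst.comp Primrec.fst) Primrec.snd)).and
    (primrecPred_wordBelow.comp
      (Primrec.pair (Primrec.snd.comp Primrec.fst) Primrec.snd))
  exact (PrimrecRel.forall_mem_list h).comp Primrec.snd Primrec.fst

theorem primrecPred_groupPresentationOk : PrimrecPred GroupPresentationOk := by
  have h : PrimrecRel fun (r : List (ℕ × Bool) × List (ℕ × Bool)) (n : ℕ) =>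
      SignedWordBelow n r.1 ∧ SignedWordBelow n r.2 :=
    (primrecPred_signedWordBelow.comp
      (Primrec.pair (Primrec.fst.comp Primrec.fst) Primrec.snd)).and
    (primrecPred_signedWordBelow.comp
      (Primrec.pair (Primrec.snd.comp Primrec.fst) Primrec.snd))
  exact (PrimrecRel.forall_mem_list h).comp Primrec.snd Primrec.fst

/-- Finite monoid presentations. -/
def MonoidPresentation : Type :=
  {p : ℕ × List (List ℕ × List ℕ) // MonoidPresentationOk p}

/-- Finite group presentations. -/
def GroupPresentation : Type :=
  {p : ℕ × List (List (ℕ × Bool) × List (ℕ × Bool)) // GroupPresentationOk p}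

instance : Primcodable MonoidPresentation :=
  Primcodable.subtype primrecPred_monoidPresentationOk

instance : Primcodable GroupPresentation :=
  Primcodable.subtype primrecPred_groupPresentationOk

/-- The relations of a finite monoid presentation on `n` generators, on the free monoid on
`Fin n`. -/
def MonoidPresentation.rels (P : MonoidPresentation) (u v : FreeMonoid (Fin P.1.1)) : Prop :=
  ((FreeMonoid.toList u).map Fin.val, (FreeMonoid.toList v).map Fin.val) ∈ P.1.2

/-- The monoid defined by a finite monoid presentation. -/
abbrev MonoidPresentation.toMonoid (P : MonoidPresentation) : Type := PresentedMonoid P.rels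

/-- The relators `u v⁻¹`, for `u = v` a relation of a finite group presentation on `n`
generators, in the free group on `Fin n`. -/
def GroupPresentation.rels (P : GroupPresentation) : Set (FreeGroup (Fin P.1.1)) :=
  {g | ∃ u v : List (Fin P.1.1 × Bool),
    (u.map (Prod.map Fin.val id), v.map (Prod.map Fin.val id)) ∈ P.1.2 ∧
      g = FreeGroup.mk u * (FreeGroup.mk v)⁻¹}

/-- The group defined by a finite group presentation. -/
abbrev GroupPresentation.toGroup (P : GroupPresentation) : Type := PresentedGroup P.rels

end Presentations

end Garside

/-! A Garside monoid is determined by a finite table. Let `S` be the set of divisors of a Garside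
element `Δ`. It is finite and closed under lcm's and under the complements `s \ t = s⁻¹ (s ∨ t)`, on
both sides. The right complement satisfies the cube identity `(s \ t) \ (s \ r) = (t \ s) \ (t \
r)`, since both sides complete `s ∨ t` to `s ∨ t ∨ r`; the left complement satisfies its mirror
image. The products `s * t = r` that hold inside `S`, with `e = 1`, present the monoid
(`IsGarsideMonoid.exists_germ`).

Conversely, finite tables that satisfy these identities and match the relations always present a
Garside monoid (`IsGermPresentation.isGarsideMonoid`). The complement extends from letters to words,
and the cube identity survives (`ComplementLaws.cube_word`). Two words are then equal in the monoid
exactly when both complements are words of neutral letters. Left cancellation and right lcm's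
follow, and the opposite monoid gives the other side. Complements of words preserve length, so every
element has finitely many divisors, which yields atomicity and gcd's.

Whether given tables are good is primitive recursive (`GermCert.primrecPred_isGood`). Hence a
presented monoid is Garside iff some good certificate presents an isomorphic monoid. This is
existential: a derivation witnesses an equality of words, and the images of the generators witness
an isomorphism (`Raw.sigmaOne_mulEquiv`).

For groups, the Ore condition embeds a Gaussian monoid in a group, so its enveloping group, which
has the same generators and relations, is its group of fractions, unique up to isomorphism. Group
presentations become monoid presentations by adding inverse letters, and the same existential form
results. The lists exist because a nonempty set of this form is the range of a computable sequence;
every Garside object has a presentation from a good certificate, which is therefore listed. -/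

namespace Garside

/-! ### Complements of words and the monoids that they define. -/

section Complement

variable {S : Type*}

/-- The laws of a right complement operation `rc s t = s⁻¹ (s ∨ t)` with neutral element `e`. -/
structure ComplementLaws (rc : S → S → S) (e : S) : Prop where
  self : ∀ s, rc s s = e
  one_left : ∀ s, rc e s = s
  one_right : ∀ s, rc s e = e
  cube : ∀ s t r, rc (rc s t) (rc s r) = rc (rc t s) (rc t r)

/-- The complement of a word by a letter. -/
def letterCompl (rc : S → S → S) : S → List S → List S
  | _, [] => []
  | s, t :: v => rc s t :: letterCompl rc (rc t s) v

/-- The complement of a letter by a word. -/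
def complLetter (rc : S → S → S) : List S → S → S
  | [], s => s
  | t :: v, s => complLetter rc v (rc t s)

/-- The complement of a word by a word. -/
def wordCompl (rc : S → S → S) : List S → List S → List S
  | [], v => v
  | s :: u, v => wordCompl rc u (letterCompl rc s v)

/-- Words all of whose letters are the neutral letter. -/
def IsTrivialWord (e : S) (w : List S) : Prop := ∀ a ∈ w, a = e

/-- The equivalence of words defined by the complement. -/
def WordEquiv (rc : S → S → S) (e : S) (u v : List S) : Prop :=
  IsTrivialWord e (wordCompl rc u v) ∧ IsTrivialWord e (wordCompl rc v u)

theorem isTrivialWord_append {e : S} {u v : List S} :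
    IsTrivialWord e (u ++ v) ↔ IsTrivialWord e u ∧ IsTrivialWord e v := by
  simp only [IsTrivialWord, List.mem_append]
  grind

theorem isTrivialWord_cons {e a : S} {v : List S} :
    IsTrivialWord e (a :: v) ↔ a = e ∧ IsTrivialWord e v := by
  simp [IsTrivialWord]

theorem isTrivialWord_nil {e : S} : IsTrivialWord e ([] : List S) := by
  simp [IsTrivialWord]

variable (rc : S → S → S)

theorem length_letterCompl (s : S) (v : List S) : (letterCompl rc s v).length = v.length := by
  induction v generalizing s with
  | nil => rfl
  | cons t v ih => simp [letterCompl, ih]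

theorem length_wordCompl (u v : List S) : (wordCompl rc u v).length = v.length := by
  induction u generalizing v with
  | nil => rfl
  | cons s u ih => simp [wordCompl, ih, length_letterCompl]

theorem wordCompl_nil (u : List S) : wordCompl rc u [] = [] := by
  simpa using length_wordCompl rc u []

/-- The complements fill a grid of letters whose sides are the two words. A concatenation on one
side cuts the grid in two, and the second part starts from what the first leaves of the other side.
-/
theorem letterCompl_append (s : S) (v w : List S) :
    letterCompl rc s (v ++ w) = letterCompl rc s v ++ letterCompl rc (complLetter rc v s) w := by
  induction v generalizing s with
  | nil => rfl
  | cons t v ih => simp [letterCompl, complLetter, ih]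

theorem wordCompl_append_left (u w v : List S) :
    wordCompl rc (u ++ w) v = wordCompl rc w (wordCompl rc u v) := by
  induction u generalizing v with
  | nil => rfl
  | cons s u ih => simp [wordCompl, ih]

theorem wordCompl_cons_right (v : List S) (s : S) (u : List S) :
    wordCompl rc v (s :: u) = complLetter rc v s :: wordCompl rc (letterCompl rc s v) u := by
  induction v generalizing s u with
  | nil => rfl
  | cons t v ih => simp [wordCompl, letterCompl, complLetter, ih]

theorem wordCompl_append_right (u v w : List S) :
    wordCompl rc u (v ++ w) = wordCompl rc u v ++ wordCompl rc (wordCompl rc v u) w := by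
  induction u generalizing v w with
  | nil => simp [wordCompl_nil, wordCompl]
  | cons s u ih => simp [wordCompl, letterCompl_append, ih, wordCompl_cons_right]

variable {rc} {e : S}

namespace ComplementLaws

theorem letterCompl_one (h : ComplementLaws rc e) (v : List S) : letterCompl rc e v = v := by
  induction v with
  | nil => rfl
  | cons t v ih => simp [letterCompl, h.one_left, h.one_right, ih]

theorem complLetter_one (h : ComplementLaws rc e) (v : List S) : complLetter rc v e = e := by
  induction v with
  | nil => rfl
  | cons t v ih => simp [complLetter, h.one_right, ih]

/-- The heads agree by the cube identity; its instances for `s r t` and `t r s` turn the tails into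
the same claim for the letters `rc r s` and `rc r t`. -/
theorem cube_letter (h : ComplementLaws rc e) (s t : S) (w : List S) :
    letterCompl rc (rc s t) (letterCompl rc s w) =
      letterCompl rc (rc t s) (letterCompl rc t w) := by
  induction w generalizing s t with
  | nil => rfl
  | cons r w ih =>
    simp only [letterCompl, h.cube s t r, h.cube s r t, h.cube t r s]
    rw [ih]

theorem cube_letter_word (h : ComplementLaws rc e) (s : S) (v w : List S) :
    wordCompl rc (letterCompl rc s v) (letterCompl rc s w) =
      letterCompl rc (complLetter rc v s) (wordCompl rc v w) := by
  induction v generalizing s w with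
  | nil => rfl
  | cons t v ih =>
    simp only [letterCompl, wordCompl, complLetter]
    rw [h.cube_letter, ih]

theorem cube_word (h : ComplementLaws rc e) (u v w : List S) :
    wordCompl rc (wordCompl rc u v) (wordCompl rc u w) =
      wordCompl rc (wordCompl rc v u) (wordCompl rc v w) := by
  induction u generalizing v w with
  | nil => simp [wordCompl_nil, wordCompl]
  | cons s u ih =>
    simp only [wordCompl_cons_right, wordCompl]
    rw [ih, h.cube_letter_word]

theorem wordCompl_of_trivial (h : ComplementLaws rc e) {u : List S} (hu : IsTrivialWord e u)
    (v : List S) : wordCompl rc u v = v := by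
  induction u with
  | nil => rfl
  | cons s u ih =>
    obtain ⟨rfl, hu⟩ := isTrivialWord_cons.1 hu
    simp [wordCompl, h.letterCompl_one, ih hu]

theorem trivial_wordCompl (h : ComplementLaws rc e) (u : List S) {v : List S}
    (hv : IsTrivialWord e v) : IsTrivialWord e (wordCompl rc u v) := by
  induction v generalizing u with
  | nil => simpa [wordCompl_nil] using hv
  | cons s v ih =>
    obtain ⟨rfl, hv⟩ := isTrivialWord_cons.1 hv
    rw [wordCompl_cons_right, isTrivialWord_cons]
    exact ⟨h.complLetter_one u, ih _ hv⟩

theorem trivial_wordCompl_self (h : ComplementLaws rc e) (u : List S) :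
    IsTrivialWord e (wordCompl rc u u) := by
  induction u with
  | nil => exact isTrivialWord_nil
  | cons s u ih =>
    simp only [wordCompl, letterCompl, h.self, h.letterCompl_one, wordCompl_cons_right,
      isTrivialWord_cons]
    exact ⟨h.complLetter_one u, ih⟩

/-- Triviality of `v \ u` means that `u` divides `v`, and this is transitivity. As `w \ v` is
trivial, the cube identity reads `w \ u = (v \ w) \ (v \ u)`, a complement of a trivial word. -/
theorem trivial_trans (h : ComplementLaws rc e) {u v w : List S}
    (huv : IsTrivialWord e (wordCompl rc v u)) (hvw : IsTrivialWord e (wordCompl rc w v)) :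
    IsTrivialWord e (wordCompl rc w u) := by
  have := h.cube_word w v u
  rw [h.wordCompl_of_trivial hvw] at this
  rw [this]
  exact h.trivial_wordCompl _ huv

theorem trivial_mul_left_iff (h : ComplementLaws rc e) (w u v : List S) :
    IsTrivialWord e (wordCompl rc (w ++ u) (w ++ v)) ↔ IsTrivialWord e (wordCompl rc u v) := by
  have hw := h.trivial_wordCompl_self w
  rw [wordCompl_append_left, wordCompl_append_right, h.wordCompl_of_trivial hw,
    wordCompl_append_right, h.wordCompl_of_trivial hw, isTrivialWord_append]
  exact and_iff_right (h.trivial_wordCompl _ hw)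

/-- Divisibility in one direction is not stable under right multiplication: both `u \ v` and `v \ u`
have to be erased. -/
theorem trivial_mul_right (h : ComplementLaws rc e) (w : List S) {u v : List S}
    (huv : WordEquiv rc e u v) : IsTrivialWord e (wordCompl rc (u ++ w) (v ++ w)) := by
  rw [wordCompl_append_left, wordCompl_append_right, h.wordCompl_of_trivial huv.2,
    wordCompl_append_right, h.wordCompl_of_trivial huv.1, isTrivialWord_append]
  exact ⟨h.trivial_wordCompl _ huv.1, h.trivial_wordCompl_self w⟩

/-- The equivalence of words, as a congruence on the free monoid. -/
def con (h : ComplementLaws rc e) : Con (FreeMonoid S) where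
  r u v := WordEquiv rc e u.toList v.toList
  iseqv :=
    { refl := fun u => ⟨h.trivial_wordCompl_self _, h.trivial_wordCompl_self _⟩
      symm := fun huv => ⟨huv.2, huv.1⟩
      trans := fun huv hvw =>
        ⟨h.trivial_trans hvw.1 huv.1, h.trivial_trans huv.2 hvw.2⟩ }
  mul' := by
    intro u u' v v' hu hv
    have h₁ : WordEquiv rc e (u.toList ++ v.toList) (u.toList ++ v'.toList) :=
      ⟨(h.trivial_mul_left_iff _ _ _).2 hv.1, (h.trivial_mul_left_iff _ _ _).2 hv.2⟩
    have h₂ : WordEquiv rc e (u.toList ++ v'.toList) (u'.toList ++ v'.toList) :=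
      ⟨h.trivial_mul_right _ hu, h.trivial_mul_right _ ⟨hu.2, hu.1⟩⟩
    exact ⟨h.trivial_trans h₂.1 h₁.1, h.trivial_trans h₁.2 h₂.2⟩

end ComplementLaws

/-- `M` is, through `ι`, the monoid presented by the generators `S` and the relations
`s * rc s t = t * rc t s` and `e = 1` of a right complement. -/
structure IsComplementPresentation {M : Type*} [Monoid M] (rc : S → S → S) (e : S) (ι : S → M) :
    Prop where
  laws : ComplementLaws rc e
  map_one : ι e = 1
  map_rel : ∀ s t, ι s * ι (rc s t) = ι t * ι (rc t s)
  wordEquiv : ∀ u v : List S, (u.map ι).prod = (v.map ι).prod → WordEquiv rc e u v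
  surj : ∀ x : M, ∃ u : List S, (u.map ι).prod = x

namespace IsComplementPresentation

variable {M : Type*} [Monoid M] {ι : S → M}

theorem prod_of_trivial (h : IsComplementPresentation rc e ι) {u : List S}
    (hu : IsTrivialWord e u) : (u.map ι).prod = 1 := by
  refine List.prod_eq_one fun x hx => ?_
  obtain ⟨a, ha, rfl⟩ := List.mem_map.1 hx
  rw [hu a ha, h.map_one]

theorem map_letter_rel (h : IsComplementPresentation rc e ι) (s : S) (v : List S) :
    ι s * ((letterCompl rc s v).map ι).prod = (v.map ι).prod * ι (complLetter rc v s) := by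
  induction v generalizing s with
  | nil => simp [letterCompl, complLetter]
  | cons t v ih =>
    simp only [letterCompl, complLetter, List.map_cons, List.prod_cons]
    rw [← mul_assoc, h.map_rel, mul_assoc, ih, mul_assoc]

theorem map_word_rel (h : IsComplementPresentation rc e ι) (u v : List S) :
    (u.map ι).prod * ((wordCompl rc u v).map ι).prod =
      (v.map ι).prod * ((wordCompl rc v u).map ι).prod := by
  induction u generalizing v with
  | nil => simp [wordCompl, wordCompl_nil]
  | cons s u ih =>
    simp only [wordCompl_cons_right, wordCompl, List.map_cons, List.prod_cons]
    rw [mul_assoc, ih, ← mul_assoc, h.map_letter_rel, mul_assoc]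

theorem prod_eq_iff (h : IsComplementPresentation rc e ι) {u v : List S} :
    (u.map ι).prod = (v.map ι).prod ↔ WordEquiv rc e u v := by
  refine ⟨h.wordEquiv u v, fun huv => ?_⟩
  simpa [h.prod_of_trivial huv.1, h.prod_of_trivial huv.2] using h.map_word_rel u v

/-- Left divisibility becomes a computation on words; lcm's and the finiteness of the divisors are
read off from it. -/
theorem dvd_iff (h : IsComplementPresentation rc e ι) {u v : List S} :
    (u.map ι).prod ∣ (v.map ι).prod ↔ IsTrivialWord e (wordCompl rc v u) := by
  constructor
  · rintro ⟨y, hy⟩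
    obtain ⟨w, rfl⟩ := h.surj y
    rw [← List.prod_append, ← List.map_append] at hy
    refine h.laws.trivial_trans (v := u ++ w) ?_ (h.wordEquiv _ _ hy).1
    rw [wordCompl_append_left]
    exact h.laws.trivial_wordCompl _ (h.laws.trivial_wordCompl_self u)
  · intro hu
    have := h.map_word_rel u v
    rw [h.prod_of_trivial hu, mul_one] at this
    exact ⟨_, this.symm⟩

theorem mul_left_cancel (h : IsComplementPresentation rc e ι) {x y z : M}
    (hxy : x * y = x * z) : y = z := by
  obtain ⟨w, rfl⟩ := h.surj x
  obtain ⟨u, rfl⟩ := h.surj y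
  obtain ⟨v, rfl⟩ := h.surj z
  rw [← List.prod_append, ← List.prod_append, ← List.map_append, ← List.map_append,
    h.prod_eq_iff] at hxy
  exact h.prod_eq_iff.2 ⟨(h.laws.trivial_mul_left_iff w u v).1 hxy.1,
    (h.laws.trivial_mul_left_iff w v u).1 hxy.2⟩

/-- The lcm of `u` and `v` is `u (u \ v)`. For a common multiple `w`, leastness requires `(u \ w) \
(u \ v)` to be trivial; by the cube identity it equals `(w \ u) \ (w \ v)`, and `w \ v` is trivial.
-/
theorem exists_isRightLcm (h : IsComplementPresentation rc e ι) (x y : M) :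
    ∃ z, IsRightLcm x y z := by
  obtain ⟨u, rfl⟩ := h.surj x
  obtain ⟨v, rfl⟩ := h.surj y
  refine ⟨(u.map ι).prod * ((wordCompl rc u v).map ι).prod, dvd_mul_right _ _, ?_, ?_⟩
  · rw [h.map_word_rel]
    exact dvd_mul_right _ _
  · intro z hu hv
    obtain ⟨w, rfl⟩ := h.surj z
    rw [h.dvd_iff] at hu hv
    rw [← List.prod_append, ← List.map_append, h.dvd_iff, wordCompl_append_right,
      isTrivialWord_append, h.laws.cube_word u w v]
    exact ⟨hu, h.laws.trivial_wordCompl _ hv⟩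

/-- A word that represents `1` consists of neutral letters, because its complement by the empty word
is itself. -/
theorem eq_one_of_mul_eq_one (h : IsComplementPresentation rc e ι) {x y : M} (hxy : x * y = 1) :
    x = 1 := by
  obtain ⟨u, rfl⟩ := h.surj x
  obtain ⟨v, rfl⟩ := h.surj y
  have := (h.wordEquiv [] (u ++ v) (by simpa using hxy.symm)).1
  exact h.prod_of_trivial (isTrivialWord_append.1 this).1

/-- A right divisor of the element represented by a word is represented by a word of the same
length. -/
theorem exists_word_of_mul_eq (h : IsComplementPresentation rc e ι) {x y : M} {v : List S}
    (hxy : x * y = (v.map ι).prod) : ∃ w : List S, w.length = v.length ∧ (w.map ι).prod = y := by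
  obtain ⟨u, rfl⟩ := h.surj x
  refine ⟨wordCompl rc u v, length_wordCompl rc u v, h.mul_left_cancel (x := (u.map ι).prod) ?_⟩
  rw [h.map_word_rel, h.prod_of_trivial (h.dvd_iff.1 ⟨y, hxy.symm⟩), mul_one, hxy]

end IsComplementPresentation

end Complement

/-! ### From a finite germ to a Garside monoid. -/

section Germ

open MulOpposite

/-- A finite family of data that describes the divisors of a Garside element `Δ`: a right
complement `rc`, a left complement `lc`, and the graph `Rel` of a partial product. -/
structure GermLaws {S : Type*} (rc lc : S → S → S) (e Δ : S) (Rel : S → S → S → Prop) :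
    Prop where
  right : ComplementLaws rc e
  left : ComplementLaws lc e
  right_top : ∀ s, rc Δ s = e
  left_top : ∀ s, lc Δ s = e
  rel_right : ∀ s t r, Rel s t r → rc r s = e ∧ rc s r = t
  rel_left : ∀ s t r, Rel s t r → lc r t = e ∧ lc t r = s
  exists_right : ∀ s t, ∃ r, Rel s (rc s t) r ∧ Rel t (rc t s) r
  exists_left : ∀ s t, ∃ r, Rel (lc s t) s r ∧ Rel (lc t s) t r

/-- `M` is, through `ι`, the monoid presented by the generators `S` and the relations `s * t = r`,
for `Rel s t r`, and `e = 1`. -/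
structure IsGermPresentation {S : Type} {M : Type*} [Monoid M] (Rel : S → S → S → Prop) (e : S)
    (ι : S → M) : Prop where
  map_one : ι e = 1
  map_mul : ∀ s t r, Rel s t r → ι s * ι t = ι r
  surj : ∀ x : M, ∃ u : List S, (u.map ι).prod = x
  lift : ∀ (N : Type) [Monoid N] (f : S → N), f e = 1 →
    (∀ s t r, Rel s t r → f s * f t = f r) → ∃ φ : M →* N, ∀ s, φ (ι s) = f s

variable {S : Type} {M : Type*} [Monoid M] {rc lc : S → S → S} {e Δ : S}
  {Rel : S → S → S → Prop} {ι : S → M}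

theorem list_prod_map_op (f : S → M) (u : List S) :
    (u.map fun s => op (f s)).prod = op (u.reverse.map f).prod := by
  rw [MulOpposite.op_list_prod]
  simp [Function.comp_def]

namespace IsGermPresentation

theorem comp_mulEquiv {M' : Type*} [Monoid M'] (h : IsGermPresentation Rel e ι) (φ : M ≃* M') :
    IsGermPresentation Rel e (fun s => φ (ι s)) where
  map_one := by rw [h.map_one, _root_.map_one]
  map_mul s t r hr := by rw [← _root_.map_mul, h.map_mul s t r hr]
  surj x := by
    obtain ⟨u, hu⟩ := h.surj (φ.symm x)
    refine ⟨u, ?_⟩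
    have : (u.map fun s => φ (ι s)) = (u.map ι).map φ := by simp [Function.comp_def]
    rw [this, ← map_list_prod, hu, φ.apply_symm_apply]
  lift N _ f h₁ h₂ := by
    obtain ⟨ψ, hψ⟩ := h.lift N f h₁ h₂
    exact ⟨ψ.comp φ.symm.toMonoidHom, fun s => by simp [hψ]⟩

/-- The universal property is applied to the quotient of the free monoid by `hl.con`, where the germ
relations hold by computation; words that are equal in `M` are therefore equivalent. -/
theorem isComplementPresentation (h : IsGermPresentation Rel e ι) (hl : ComplementLaws rc e)
    (hrel : ∀ s t r, Rel s t r → rc r s = e ∧ rc s r = t)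
    (hex : ∀ s t, ∃ r, Rel s (rc s t) r ∧ Rel t (rc t s) r) :
    IsComplementPresentation rc e ι where
  laws := hl
  map_one := h.map_one
  map_rel s t := by
    obtain ⟨r, h₁, h₂⟩ := hex s t
    rw [h.map_mul _ _ _ h₁, h.map_mul _ _ _ h₂]
  surj := h.surj
  wordEquiv u v huv := by
    obtain ⟨φ, hφ⟩ := h.lift hl.con.Quotient (fun s => hl.con.mk' (FreeMonoid.of s))
      (by
        rw [← _root_.map_one hl.con.mk']
        refine (Con.eq _).2 ?_
        change WordEquiv rc e [e] []
        simp [WordEquiv, wordCompl, letterCompl, IsTrivialWord])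
      (by
        intro s t r hr
        rw [← _root_.map_mul]
        refine (Con.eq _).2 ?_
        change WordEquiv rc e [s, t] [r]
        obtain ⟨h₁, h₂⟩ := hrel s t r hr
        simp [WordEquiv, wordCompl, letterCompl, IsTrivialWord, h₁, h₂, hl.self])
    have key : ∀ w : List S, φ (w.map ι).prod = hl.con.mk' (FreeMonoid.ofList w) := by
      intro w
      induction w with
      | nil => simp
      | cons a w ih => simp [ih, hφ, FreeMonoid.ofList_cons]
    have := congrArg φ huv
    rw [key, key] at this
    exact (Con.eq _).1 this

/-- A left complement is a right complement in the opposite monoid, so the theory of right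
complements serves both sides. -/
theorem op (h : IsGermPresentation Rel e ι) :
    IsGermPresentation (fun s t r => Rel t s r) e (fun s => op (ι s)) where
  map_one := by rw [h.map_one, op_one]
  map_mul s t r hr := by rw [← op_mul, h.map_mul _ _ _ hr]
  surj x := by
    obtain ⟨u, hu⟩ := h.surj x.unop
    exact ⟨u.reverse, by rw [list_prod_map_op, List.reverse_reverse, hu, op_unop]⟩
  lift N _ f h₁ h₂ := by
    obtain ⟨φ, hφ⟩ := h.lift Nᵐᵒᵖ (fun s => MulOpposite.op (f s)) (by rw [h₁, op_one])
      (fun s t r hr => by rw [← op_mul, h₂ _ _ _ hr])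
    refine ⟨⟨⟨fun x => (φ x.unop).unop, by simp⟩, fun x y => by simp⟩, fun s => ?_⟩
    change (φ (ι s)).unop = f s
    rw [hφ, unop_op]

end IsGermPresentation

/-! ### Atomicity and gcd's from the finiteness of divisors. -/

section Finiteness

theorem finite_setOf_prod_length [Finite S] (f : S → M) (n : ℕ) :
    {x : M | ∃ w : List S, w.length = n ∧ (w.map f).prod = x}.Finite := by
  refine ((List.finite_length_eq S n).image fun w => (w.map f).prod).subset ?_
  rintro x ⟨w, hw, rfl⟩
  exact ⟨w, hw, rfl⟩

/-- The number of left divisors is the norm behind atomicity. Multiplication by `y` embeds the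
divisors of `z` in those of `y * z` and misses `1`; in the companion lemma for the left factor, the
missed divisor is `y * z` itself. -/
theorem ncard_divisors_lt_of_ne_one (hcancel : ∀ x y z : M, x * y = x * z → y = z)
    (hone : ∀ x y : M, x * y = 1 → x = 1) (hfin : ∀ x : M, {y : M | y ∣ x}.Finite)
    {y z : M} (hy : y ≠ 1) :
    {w : M | w ∣ z}.ncard < {w : M | w ∣ y * z}.ncard := by
  rw [← Set.ncard_image_of_injective {w : M | w ∣ z} (fun a b h => hcancel y a b h)]
  refine Set.ncard_lt_ncard ⟨?_, fun h => ?_⟩ (hfin _)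
  · rintro _ ⟨w, hw, rfl⟩
    exact mul_dvd_mul_left y hw
  · obtain ⟨w, -, hw⟩ := h (show (1 : M) ∈ {w : M | w ∣ y * z} from one_dvd _)
    exact hy (hone _ _ hw)

theorem ncard_divisors_lt_of_ne_one' (hcancel : ∀ x y z : M, x * y = x * z → y = z)
    (hone : ∀ x y : M, x * y = 1 → x = 1) (hfin : ∀ x : M, {y : M | y ∣ x}.Finite)
    {y z : M} (hz : z ≠ 1) :
    {w : M | w ∣ y}.ncard < {w : M | w ∣ y * z}.ncard := by
  refine Set.ncard_lt_ncard ⟨fun w hw => hw.trans (dvd_mul_right _ _), fun h => ?_⟩ (hfin _)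
  obtain ⟨w, hw⟩ := h (show y * z ∈ {w : M | w ∣ y * z} from dvd_refl _)
  exact hz (hone z w (hcancel y _ _ (by rw [← mul_assoc, ← hw, mul_one])))

/-- A left cancellative monoid without nontrivial units in which every element has finitely many
left divisors is atomic. -/
theorem isAtomicMonoid_of_finite_divisors (hcancel : ∀ x y z : M, x * y = x * z → y = z)
    (hone : ∀ x y : M, x * y = 1 → x = 1) (hfin : ∀ x : M, {y : M | y ∣ x}.Finite) :
    IsAtomicMonoid M where
  closure_atoms := by
    rw [Submonoid.eq_top_iff']
    intro x
    induction hn : {w : M | w ∣ x}.ncard using Nat.strong_induction_on generalizing x with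
    | _ n ih =>
      by_cases hx : x = 1
      · rw [hx]
        exact one_mem _
      by_cases ha : IsMonoidAtom x
      · exact Submonoid.subset_closure ha
      simp only [IsMonoidAtom, not_and, not_forall, not_or] at ha
      obtain ⟨y, z, rfl, hy, hz⟩ := ha hx
      subst hn
      exact mul_mem (ih _ (ncard_divisors_lt_of_ne_one' hcancel hone hfin hz) _ rfl)
        (ih _ (ncard_divisors_lt_of_ne_one hcancel hone hfin hy) _ rfl)
  norm_finite x := by
    refine ⟨{w : M | w ∣ x}.ncard, fun l => ?_⟩
    induction l generalizing x with
    | nil => simp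
    | cons a l ih =>
      rintro hl rfl
      have h₁ := ih l.prod (fun b hb => hl b (List.mem_cons_of_mem _ hb)) rfl
      have h₂ := ncard_divisors_lt_of_ne_one hcancel hone hfin (z := l.prod)
        (hl a List.mem_cons_self).1
      rw [List.prod_cons, List.length_cons]
      omega

/-- The left gcd is the right lcm of the finitely many common left divisors. -/
theorem exists_isLeftGcd_of_finite_divisors (hfin : ∀ x : M, {y : M | y ∣ x}.Finite)
    (hlcm : ∀ x y : M, ∃ z, IsRightLcm x y z) (x y : M) :
    ∃ z, IsLeftGcd x y z := by
  have key : ∀ s : Set M, s.Finite → ∃ z, (∀ w ∈ s, w ∣ z) ∧ ∀ v, (∀ w ∈ s, w ∣ v) → z ∣ v := by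
    intro s hs
    induction s, hs using Set.Finite.induction_on with
    | empty => exact ⟨1, by simp⟩
    | @insert a s _ _ ih =>
      obtain ⟨z, hz₁, hz₂⟩ := ih
      obtain ⟨m, h₁, h₂, h₃⟩ := hlcm a z
      refine ⟨m, ?_, fun v hv => ?_⟩
      · rintro w (rfl | hw)
        exacts [h₁, (hz₁ w hw).trans h₂]
      · exact h₃ v (hv a (Set.mem_insert _ _))
          (hz₂ v fun w hw => hv w (Set.mem_insert_of_mem _ hw))
  obtain ⟨z, h₁, h₂⟩ := key {w | w ∣ x ∧ w ∣ y} ((hfin x).subset fun w hw => hw.1)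
  exact ⟨z, h₂ x fun w hw => hw.1, h₂ y fun w hw => hw.2, fun w hx hy => h₁ w ⟨hx, hy⟩⟩

end Finiteness

theorem IsComplementPresentation.finite_right_divisors [Finite S]
    (h : IsComplementPresentation rc e ι) (y : M) : {x : M | x ∣ᵣ y}.Finite := by
  obtain ⟨v, rfl⟩ := h.surj y
  refine (finite_setOf_prod_length ι v.length).subset ?_
  rintro x ⟨z, hz⟩
  exact h.exists_word_of_mul_eq hz.symm

/-- `ι s` is represented by a word of length one, hence so is each of its right divisors. -/
theorem IsComplementPresentation.exists_letter_of_rightDvd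
    (h : IsComplementPresentation rc e ι) {x : M} {s : S} (hx : x ∣ᵣ ι s) : ∃ t, ι t = x := by
  obtain ⟨z, hz⟩ := hx
  obtain ⟨w, hw, rfl⟩ := h.exists_word_of_mul_eq (v := [s]) (x := z) (y := x) (by simp [hz])
  obtain ⟨t, rfl⟩ := List.length_eq_one_iff.1 hw
  exact ⟨t, by simp⟩

theorem IsComplementPresentation.letter_dvd_top
    (h : IsComplementPresentation rc e ι) (htop : ∀ s, rc Δ s = e) (s : S) : ι s ∣ ι Δ := by
  have := (h.dvd_iff (u := [s]) (v := [Δ])).2 (by simp [wordCompl, letterCompl, IsTrivialWord, htop])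
  simpa using this

theorem dvd_iff_op_rightDvd_op {x y : M} : x ∣ y ↔ MulOpposite.op x ∣ᵣ MulOpposite.op y := by
  constructor
  · rintro ⟨z, rfl⟩
    exact ⟨MulOpposite.op z, rfl⟩
  · rintro ⟨z, hz⟩
    exact ⟨z.unop, MulOpposite.op_injective hz⟩

theorem exists_isLeftLcm_of_op (h : ∀ x y : Mᵐᵒᵖ, ∃ z, IsRightLcm x y z) (x y : M) :
    ∃ z, IsLeftLcm x y z := by
  obtain ⟨z, h₁, h₂, h₃⟩ := h (MulOpposite.op x) (MulOpposite.op y)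
  refine ⟨z.unop, rightDvd_iff_op_dvd_op.2 h₁, rightDvd_iff_op_dvd_op.2 h₂, fun w hx hy => ?_⟩
  exact rightDvd_iff_op_dvd_op.2
    (h₃ _ (rightDvd_iff_op_dvd_op.1 hx) (rightDvd_iff_op_dvd_op.1 hy))

theorem exists_isRightGcd_of_op (h : ∀ x y : Mᵐᵒᵖ, ∃ z, IsLeftGcd x y z) (x y : M) :
    ∃ z, IsRightGcd x y z := by
  obtain ⟨z, h₁, h₂, h₃⟩ := h (MulOpposite.op x) (MulOpposite.op y)
  refine ⟨z.unop, rightDvd_iff_op_dvd_op.2 h₁, rightDvd_iff_op_dvd_op.2 h₂, fun w hx hy => ?_⟩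
  exact rightDvd_iff_op_dvd_op.2
    (h₃ _ (rightDvd_iff_op_dvd_op.1 hx) (rightDvd_iff_op_dvd_op.1 hy))

/-- A monoid presented by a finite germ that satisfies the germ laws is a Garside monoid. -/
theorem IsGermPresentation.isGarsideMonoid [Finite S] (h : IsGermPresentation Rel e ι)
    (hg : GermLaws rc lc e Δ Rel) : IsGarsideMonoid M := by
  have hr : IsComplementPresentation rc e ι :=
    h.isComplementPresentation hg.right hg.rel_right hg.exists_right
  have hl : IsComplementPresentation lc e (fun s => MulOpposite.op (ι s)) :=
    h.op.isComplementPresentation hg.left (fun s t r => hg.rel_left t s r) hg.exists_left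
  -- The length argument bounds right divisors; left divisors are the right divisors in the opposite
  -- monoid, so the finiteness of left divisors comes from `lc`.
  have hfin : ∀ x : M, {y : M | y ∣ x}.Finite := fun x => by
    refine Set.Finite.of_finite_image (f := MulOpposite.op) ?_ MulOpposite.op_injective.injOn
    refine (hl.finite_right_divisors (MulOpposite.op x)).subset ?_
    rintro _ ⟨y, hy, rfl⟩
    exact dvd_iff_op_rightDvd_op.1 hy
  have hfin' : ∀ x : Mᵐᵒᵖ, {y : Mᵐᵒᵖ | y ∣ x}.Finite := fun x => by
    refine Set.Finite.of_finite_image (f := MulOpposite.unop) ?_ MulOpposite.unop_injective.injOn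
    refine (hr.finite_right_divisors x.unop).subset ?_
    rintro _ ⟨y, hy, rfl⟩
    exact rightDvd_iff_op_dvd_op.2 hy
  -- On either side the divisors of `ι Δ` are exactly the letters: letters divide it by the top
  -- laws, and divisors of a letter are letters.
  have hleft : ∀ x, x ∣ ι Δ ↔ ∃ s, ι s = x := by
    refine fun x => ⟨fun hx => ?_, ?_⟩
    · obtain ⟨t, ht⟩ := hl.exists_letter_of_rightDvd (dvd_iff_op_rightDvd_op.1 hx)
      exact ⟨t, MulOpposite.op_injective ht⟩
    · rintro ⟨s, rfl⟩
      exact hr.letter_dvd_top hg.right_top s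
  have hright : ∀ x, x ∣ᵣ ι Δ ↔ ∃ s, ι s = x := by
    refine fun x => ⟨hr.exists_letter_of_rightDvd, ?_⟩
    rintro ⟨s, rfl⟩
    exact rightDvd_iff_op_dvd_op.2 (hl.letter_dvd_top hg.left_top s)
  refine ⟨⟨?_, ?_, ?_, ?_, ?_, ?_⟩, ι Δ, ?_, ?_, ?_⟩
  · exact isAtomicMonoid_of_finite_divisors (fun _ _ _ => hr.mul_left_cancel)
      (fun _ _ => hr.eq_one_of_mul_eq_one) hfin
  · have : IsLeftCancelMul M := ⟨fun x y z => hr.mul_left_cancel⟩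
    have : IsRightCancelMul M := ⟨fun x y z hyz => MulOpposite.op_injective
      (hl.mul_left_cancel (x := MulOpposite.op x) (congrArg MulOpposite.op hyz))⟩
    exact {}
  · exact hr.exists_isRightLcm
  · exact exists_isLeftLcm_of_op hl.exists_isRightLcm
  · exact exists_isRightGcd_of_op (exists_isLeftGcd_of_finite_divisors hfin' hl.exists_isRightLcm)
  · exact exists_isLeftGcd_of_finite_divisors hfin hr.exists_isRightLcm
  · exact fun x => (hleft x).trans (hright x).symm
  · exact hfin _
  · rw [Submonoid.eq_top_iff']
    intro x
    obtain ⟨u, rfl⟩ := h.surj x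
    refine Submonoid.list_prod_mem _ fun y hy => Submonoid.subset_closure ?_
    obtain ⟨s, -, rfl⟩ := List.mem_map.1 hy
    exact (hleft _).2 ⟨s, rfl⟩

end Germ

/-! ### From a Garside monoid to a finite germ. -/

section ExistsGerm

variable {M : Type*} [Monoid M]

/-- If `x` had a nonempty decomposition into atoms, the powers of `x * y` would decompose `1` into
arbitrarily many atoms; `n + 1` factors already exceed the bound `n`. -/
theorem IsAtomicMonoid.eq_one_of_mul_eq_one (h : IsAtomicMonoid M) {x y : M} (hxy : x * y = 1) :
    x = 1 := by
  obtain ⟨l, hl, rfl⟩ := Submonoid.exists_list_of_mem_closure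
    (show x ∈ Submonoid.closure {a : M | IsMonoidAtom a} by rw [h.closure_atoms]; trivial)
  obtain ⟨l', hl', rfl⟩ := Submonoid.exists_list_of_mem_closure
    (show y ∈ Submonoid.closure {a : M | IsMonoidAtom a} by rw [h.closure_atoms]; trivial)
  obtain ⟨n, hn⟩ := h.norm_finite 1
  have := hn (List.replicate (n + 1) (l ++ l')).flatten
    (by
      intro a ha
      obtain ⟨k, hk, hak⟩ := List.mem_flatten.1 ha
      rw [List.eq_of_mem_replicate hk] at hak
      rcases List.mem_append.1 hak with h | h
      exacts [hl a h, hl' a h])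
    (by simp [List.prod_flatten, hxy])
  rcases l with _ | ⟨a, l⟩
  · rfl
  · simp only [List.length_flatten, List.map_replicate, List.sum_replicate, smul_eq_mul,
      List.length_append, List.length_cons] at this
    nlinarith [Nat.zero_le ((n + 1) * (l.length + l'.length))]

section LcmComplement

variable {S : Type*} {ι : S → M} {rc : S → S → S} {e : S}

theorem dvd_antisymm_of_cancel (hcancel : ∀ x y z : M, x * y = x * z → y = z)
    (hone : ∀ x y : M, x * y = 1 → x = 1) {a b : M} (hab : a ∣ b) (hba : b ∣ a) : a = b := by
  obtain ⟨c, rfl⟩ := hab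
  obtain ⟨d, hd⟩ := hba
  rw [hone c d (hcancel a _ _ (by rw [← mul_assoc, ← hd, mul_one])), mul_one]

theorem IsRightLcm.dvd_iff {a b z : M} (h : IsRightLcm a b z) (w : M) :
    z ∣ w ↔ a ∣ w ∧ b ∣ w :=
  ⟨fun hz => ⟨h.1.trans hz, h.2.1.trans hz⟩, fun hw => h.2.2 w hw.1 hw.2⟩

theorem mul_dvd_mul_left_iff_of_cancel (hcancel : ∀ x y z : M, x * y = x * z → y = z)
    {x y z : M} : x * y ∣ x * z ↔ y ∣ z := by
  refine ⟨?_, mul_dvd_mul_left x⟩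
  rintro ⟨c, hc⟩
  exact ⟨c, hcancel x _ _ (by rw [hc, mul_assoc])⟩

/-- `rc` is the right complement operation defined by right lcm's on a family of elements of a
left cancellative monoid without nontrivial units. -/
structure IsLcmComplement (ι : S → M) (rc : S → S → S) (e : S) : Prop where
  cancel : ∀ x y z : M, x * y = x * z → y = z
  one : ∀ x y : M, x * y = 1 → x = 1
  inj : Function.Injective ι
  map_one : ι e = 1
  lcm : ∀ s t, IsRightLcm (ι s) (ι t) (ι s * ι (rc s t))

namespace IsLcmComplement

/-- An element is determined by its right multiples, so identities between lcm's reduce to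
propositional logic. -/
theorem eq_of_dvd_iff (h : IsLcmComplement ι rc e) {x y : M} (hxy : ∀ w, x ∣ w ↔ y ∣ w) : x = y :=
  dvd_antisymm_of_cancel h.cancel h.one ((hxy y).2 dvd_rfl) ((hxy x).1 dvd_rfl)

theorem mul_comm_compl (h : IsLcmComplement ι rc e) (s t : S) :
    ι s * ι (rc s t) = ι t * ι (rc t s) :=
  h.eq_of_dvd_iff fun w => by rw [(h.lcm s t).dvd_iff, (h.lcm t s).dvd_iff, and_comm]

theorem eq_of_mul_eq (h : IsLcmComplement ι rc e) {s t r : S} (hr : ι s * ι t = ι r) :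
    rc s r = t := by
  refine h.inj (h.cancel (ι s) _ _ (h.eq_of_dvd_iff fun w => ?_))
  rw [(h.lcm s r).dvd_iff, hr, and_iff_right_of_imp]
  rw [← hr]
  exact fun hw => (dvd_mul_right _ _).trans hw

theorem eq_one_of_dvd (h : IsLcmComplement ι rc e) {s t : S} (hst : ι t ∣ ι s) : rc s t = e := by
  refine h.inj (h.cancel (ι s) _ _ (h.eq_of_dvd_iff fun w => ?_))
  rw [(h.lcm s t).dvd_iff, h.map_one, mul_one, and_iff_left_of_imp]
  exact fun hw => hst.trans hw

/-- The product is the lcm of `s`, `t` and `r`. The right-hand side is symmetric in the three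
letters, and this symmetry is the source of the cube identity. -/
theorem triple_dvd_iff (h : IsLcmComplement ι rc e) (s t r : S) (w : M) :
    ι s * (ι (rc s t) * ι (rc (rc s t) (rc s r))) ∣ w ↔ ι s ∣ w ∧ ι t ∣ w ∧ ι r ∣ w := by
  constructor
  · intro hw
    obtain ⟨w, rfl⟩ : ι s ∣ w := (dvd_mul_right _ _).trans hw
    rw [mul_dvd_mul_left_iff_of_cancel h.cancel, (h.lcm _ _).dvd_iff,
      ← mul_dvd_mul_left_iff_of_cancel h.cancel (x := ι s),
      ← mul_dvd_mul_left_iff_of_cancel h.cancel (x := ι s) (z := w),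
      (h.lcm _ _).dvd_iff, (h.lcm _ _).dvd_iff] at hw
    tauto
  · rintro ⟨⟨w, rfl⟩, hw⟩
    rw [mul_dvd_mul_left_iff_of_cancel h.cancel, (h.lcm _ _).dvd_iff,
      ← mul_dvd_mul_left_iff_of_cancel h.cancel (x := ι s),
      ← mul_dvd_mul_left_iff_of_cancel h.cancel (x := ι s) (z := w),
      (h.lcm _ _).dvd_iff, (h.lcm _ _).dvd_iff]
    exact ⟨⟨dvd_mul_right _ _, hw.1⟩, dvd_mul_right _ _, hw.2⟩

theorem complementLaws (h : IsLcmComplement ι rc e) : ComplementLaws rc e where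
  self s := h.eq_one_of_dvd dvd_rfl
  one_left s := h.eq_of_mul_eq (by rw [h.map_one, one_mul])
  one_right s := h.eq_one_of_dvd (by rw [h.map_one]; exact one_dvd _)
  cube s t r := by
    -- Multiplied by the lcm of `s` and `t`, both sides become the lcm of `s`, `t` and `r`.
    refine h.inj (h.cancel (ι s * ι (rc s t)) _ _ ?_)
    nth_rewrite 2 [h.mul_comm_compl]
    rw [mul_assoc, mul_assoc]
    refine h.eq_of_dvd_iff fun w => ?_
    rw [h.triple_dvd_iff, h.triple_dvd_iff]
    tauto

/-- If a letter divides the element represented by a word, then the quotient is represented by a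
word such that the factorization holds in every monoid that satisfies the complement relations. -/
theorem exists_word_quotient (h : IsLcmComplement ι rc e) {N : Type*} [Monoid N] {f : S → N}
    (hf : ∀ s t, f s * f (rc s t) = f t * f (rc t s)) (hf₁ : f e = 1) (v : List S) (s : S) (y : M)
    (hv : (v.map ι).prod = ι s * y) :
    ∃ w : List S, (w.map ι).prod = y ∧ (v.map f).prod = f s * (w.map f).prod := by
  induction v generalizing s y with
  | nil =>
    have hs : s = e := h.inj (by rw [h.map_one]; exact h.one _ y hv.symm)
    subst hs
    refine ⟨[], ?_, by simp [hf₁]⟩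
    simpa [h.map_one] using hv
  | cons t v ih =>
    rw [List.map_cons, List.prod_cons] at hv
    -- The lcm of `t` and `s` divides the whole product; after cancelling `t`, the letter `rc t s`
    -- divides the rest of the word.
    obtain ⟨z, hz⟩ := (h.lcm t s).2.2 (ι s * y) ⟨_, hv.symm⟩ (dvd_mul_right _ _)
    obtain ⟨w, hw, hw'⟩ := ih (rc t s) z (h.cancel (ι t) _ _ (by rw [hv, hz, mul_assoc]))
    refine ⟨rc s t :: w, h.cancel (ι s) _ _ ?_, ?_⟩
    · rw [List.map_cons, List.prod_cons, hw, ← mul_assoc, h.mul_comm_compl, hz]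
    · rw [List.map_cons, List.map_cons, List.prod_cons, List.prod_cons, hw', ← mul_assoc,
        ← mul_assoc, hf]

/-- Equality in `M` follows from the complement relations alone: the first letter of `u` is divided
out of `v` by a factorization valid in `N` too. So these relations present the part of `M` generated
by the letters. -/
theorem prod_eq_of_prod_eq (h : IsLcmComplement ι rc e) {N : Type*} [Monoid N] {f : S → N}
    (hf : ∀ s t, f s * f (rc s t) = f t * f (rc t s)) (hf₁ : f e = 1) (u v : List S)
    (huv : (u.map ι).prod = (v.map ι).prod) : (u.map f).prod = (v.map f).prod := by
  induction u generalizing v with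
  | nil =>
    induction v with
    | nil => rfl
    | cons t v ih =>
      rw [List.map_nil, List.prod_nil, List.map_cons, List.prod_cons] at huv
      have ht := h.one _ _ huv.symm
      rw [ht, one_mul] at huv
      rw [List.map_cons, List.prod_cons, ← ih huv,
        h.inj (show ι t = ι e by rw [ht, h.map_one]), hf₁]
      simp
  | cons s u ih =>
    rw [List.map_cons, List.prod_cons] at huv
    obtain ⟨w, hw, hw'⟩ := h.exists_word_quotient hf hf₁ v s _ huv.symm
    rw [hw', List.map_cons, List.prod_cons, ih w hw.symm]

end IsLcmComplement

end LcmComplement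

/-- Every Garside monoid is presented by the germ of the divisors of a Garside element. -/
theorem IsGarsideMonoid.exists_germ (h : IsGarsideMonoid M) :
    ∃ (n : ℕ) (ι : Fin n → M) (rc lc : Fin n → Fin n → Fin n) (e Δ : Fin n),
      GermLaws rc lc e Δ (fun s t r => ι s * ι t = ι r) ∧
      IsGermPresentation (fun s t r => ι s * ι t = ι r) e ι := by
  obtain ⟨hG, D, hD⟩ := h
  have := hG.cancel
  have hone : ∀ x y : M, x * y = 1 → x = 1 := fun x y => hG.atomic.eq_one_of_mul_eq_one
  have hcancel : ∀ x y z : M, x * y = x * z → y = z := fun x y z => mul_left_cancel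
  have hone' : ∀ x y : Mᵐᵒᵖ, x * y = 1 → x = 1 := fun x y hxy => by
    have h₁ : y.unop * x.unop = 1 := congrArg MulOpposite.unop hxy
    have h₂ := hone _ _ h₁
    rw [h₂, one_mul] at h₁
    exact MulOpposite.unop_injective h₁
  have hcancel' : ∀ x y z : Mᵐᵒᵖ, x * y = x * z → y = z := fun x y z => mul_left_cancel
  have := hD.finite.to_subtype
  obtain ⟨n, ⟨E⟩⟩ := Finite.exists_equiv_fin {x : M | x ∣ D}
  let ι : Fin n → M := fun s => (E.symm s).1
  have hinj : Function.Injective ι := Subtype.val_injective.comp E.symm.injective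
  have hdvd : ∀ x, x ∣ D ↔ ∃ s, ι s = x := fun x =>
    ⟨fun hx => ⟨E ⟨x, hx⟩, by simp [ι]⟩, by rintro ⟨s, rfl⟩; exact (E.symm s).2⟩
  have hrdvd : ∀ x, x ∣ᵣ D ↔ ∃ s, ι s = x := fun x => (hD.left_iff_right x).symm.trans (hdvd x)
  obtain ⟨e, he⟩ := (hdvd 1).1 (one_dvd _)
  obtain ⟨Δ, hΔ⟩ := (hdvd D).1 dvd_rfl
  have hrc : ∀ s t, ∃ r q, IsRightLcm (ι s) (ι t) (ι s * ι r) ∧ ι s * ι r = ι q := by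
    intro s t
    obtain ⟨z, hz⟩ := hG.right_lcm (ι s) (ι t)
    have hzD := hz.2.2 D ((hdvd _).2 ⟨s, rfl⟩) ((hdvd _).2 ⟨t, rfl⟩)
    obtain ⟨q, hq⟩ := (hdvd z).1 hzD
    obtain ⟨c, rfl⟩ := hz.1
    -- Complements of divisors are divisors: `D = ι s * c * k` makes `c * k` a right divisor of `D`,
    -- hence a left divisor, and then so is its left factor `c`.
    obtain ⟨r, rfl⟩ := (hdvd c).1 (by
      obtain ⟨k, hk⟩ := hzD
      refine (dvd_mul_right c k).trans ((hD.left_iff_right _).2 ⟨ι s, ?_⟩)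
      rw [hk, mul_assoc])
    exact ⟨r, q, hz, hq.symm⟩
  have hlc : ∀ s t, ∃ r q, IsLeftLcm (ι s) (ι t) (ι r * ι s) ∧ ι r * ι s = ι q := by
    intro s t
    obtain ⟨z, hz⟩ := hG.left_lcm (ι s) (ι t)
    have hzD := hz.2.2 D ((hrdvd _).2 ⟨s, rfl⟩) ((hrdvd _).2 ⟨t, rfl⟩)
    obtain ⟨q, hq⟩ := (hrdvd z).1 hzD
    obtain ⟨c, rfl⟩ := hz.1
    obtain ⟨r, rfl⟩ := (hrdvd c).1 (by
      obtain ⟨k, hk⟩ := hzD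
      refine (RightDvd.mul_self c k).trans ((hD.left_iff_right _).1 ⟨ι s, ?_⟩)
      rw [hk, mul_assoc])
    exact ⟨r, q, hz, hq.symm⟩
  choose rc rq hrc hrq using hrc
  choose lc lq hlc hlq using hlc
  have hr : IsLcmComplement ι rc e := ⟨hcancel, hone, hinj, he, hrc⟩
  have hl : IsLcmComplement (fun s => MulOpposite.op (ι s)) lc e := by
    refine ⟨hcancel', hone', MulOpposite.op_injective.comp hinj, by rw [he, MulOpposite.op_one],
      fun s t => ?_⟩
    obtain ⟨h₁, h₂, h₃⟩ := hlc s t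
    refine ⟨rightDvd_iff_op_dvd_op.1 h₁, rightDvd_iff_op_dvd_op.1 h₂, fun w hw₁ hw₂ => ?_⟩
    exact rightDvd_iff_op_dvd_op.1
      (h₃ w.unop (rightDvd_iff_op_dvd_op.2 hw₁) (rightDvd_iff_op_dvd_op.2 hw₂))
  have hsurj : ∀ x : M, ∃ u : List (Fin n), (u.map ι).prod = x := by
    intro x
    obtain ⟨l, hl, rfl⟩ := Submonoid.exists_list_of_mem_closure
      (show x ∈ Submonoid.closure {x : M | x ∣ D} by rw [hD.closure_divisors]; trivial)
    clear hr
    induction l with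
    | nil => exact ⟨[], rfl⟩
    | cons a l ih =>
      obtain ⟨u, hu⟩ := ih fun y hy => hl y (List.mem_cons_of_mem _ hy)
      obtain ⟨s, hs⟩ := (hdvd a).1 (hl a List.mem_cons_self)
      exact ⟨s :: u, by simp [hs, hu]⟩
  refine ⟨n, ι, rc, lc, e, Δ, ⟨hr.complementLaws, hl.complementLaws, fun s => ?_, fun s => ?_,
    fun s t r hrel => ⟨hr.eq_one_of_dvd ⟨_, hrel.symm⟩, hr.eq_of_mul_eq hrel⟩,
    fun s t r hrel => ⟨hl.eq_one_of_dvd ?_, hl.eq_of_mul_eq ?_⟩, fun s t => ?_, fun s t => ?_⟩,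
    ⟨he, fun _ _ _ => id, hsurj, fun N _ f hf₁ hf => ?_⟩⟩
  · exact hr.eq_one_of_dvd (by rw [hΔ]; exact (hdvd _).2 ⟨s, rfl⟩)
  · exact hl.eq_one_of_dvd (rightDvd_iff_op_dvd_op.1 (by rw [hΔ]; exact (hrdvd _).2 ⟨s, rfl⟩))
  · exact rightDvd_iff_op_dvd_op.1 ⟨_, hrel.symm⟩
  · exact congrArg MulOpposite.op hrel
  · exact ⟨rq s t, hrq s t, by rw [← hr.mul_comm_compl, hrq]⟩
  · refine ⟨lq s t, hlq s t, ?_⟩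
    rw [← hlq]
    exact MulOpposite.op_injective (hl.mul_comm_compl t s)
  · have hf₂ : ∀ s t, f s * f (rc s t) = f t * f (rc t s) := fun s t => by
      rw [hf _ _ _ (hrq s t), hf t (rc t s) (rq s t) (by rw [← hr.mul_comm_compl, hrq])]
    -- The homomorphism is computed on an arbitrary representing word; `prod_eq_of_prod_eq` makes
    -- the choice irrelevant.
    choose word hword using hsurj
    refine ⟨⟨⟨fun x => ((word x).map f).prod, ?_⟩, fun x y => ?_⟩, fun s => ?_⟩
    · exact hr.prod_eq_of_prod_eq hf₂ hf₁ _ [] (by rw [hword]; rfl)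
    · change _ = ((word x).map f).prod * ((word y).map f).prod
      rw [← List.prod_append, ← List.map_append]
      refine hr.prod_eq_of_prod_eq hf₂ hf₁ _ _ ?_
      rw [hword, List.map_append, List.prod_append, hword, hword]
    · refine (hr.prod_eq_of_prod_eq hf₂ hf₁ _ [s] ?_).trans (by simp)
      rw [hword]
      simp

end ExistsGerm

/-! ### Closure properties and enumeration of projections of primitive recursive relations. -/

section SigmaOne

variable {α β : Type*} [Primcodable α] [Primcodable β]

/-- `p` is the projection of a primitive recursive relation. -/
def SigmaOne (p : α → Prop) : Prop :=
  ∃ r : α → ℕ → Bool, Primrec₂ r ∧ ∀ a, p a ↔ ∃ n, r a n = true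

theorem primrecPred_forall_lt {p : α × ℕ → Prop} (hp : PrimrecPred p) {f : α → ℕ}
    (hf : Primrec f) : PrimrecPred fun a => ∀ x < f a, p (a, x) :=
  ((PrimrecRel.forall_mem_list (R := fun x a => p (a, x))
    (hp.comp (Primrec.pair Primrec.snd Primrec.fst))).comp (Primrec.list_range.comp hf)
      Primrec.id).of_eq fun a => by simp

theorem primrecPred_exists_lt {p : α × ℕ → Prop} (hp : PrimrecPred p) {f : α → ℕ}
    (hf : Primrec f) : PrimrecPred fun a => ∃ x < f a, p (a, x) :=
  ((PrimrecRel.exists_mem_list (R := fun x a => p (a, x))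
    (hp.comp (Primrec.pair Primrec.snd Primrec.fst))).comp (Primrec.list_range.comp hf)
      Primrec.id).of_eq fun a => by simp

theorem primrecPred_forall_mem {p : α × β → Prop} (hp : PrimrecPred p) {f : α → List β}
    (hf : Primrec f) : PrimrecPred fun a => ∀ x ∈ f a, p (a, x) :=
  (PrimrecRel.forall_mem_list (R := fun x a => p (a, x))
    (hp.comp (Primrec.pair Primrec.snd Primrec.fst))).comp hf Primrec.id

theorem primrecPred_mem {f : α → β} {g : α → List β} (hf : Primrec f) (hg : Primrec g) :
    PrimrecPred fun a => f a ∈ g a :=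
  ((PrimrecRel.exists_mem_list (R := fun x y : β => x = y) Primrec.eq).comp hg hf).of_eq
    fun a => by simp

theorem SigmaOne.of_primrecPred {p : α → Prop} (hp : PrimrecPred p) : SigmaOne p := by
  obtain ⟨_, hp⟩ := hp
  exact ⟨fun a _ => decide (p a), hp.comp Primrec.fst, fun a => by simp⟩

namespace SigmaOne

theorem of_eq {p q : α → Prop} (hp : SigmaOne p) (h : ∀ a, p a ↔ q a) : SigmaOne q := by
  obtain ⟨r, hr, hpr⟩ := hp
  exact ⟨r, hr, fun a => (h a).symm.trans (hpr a)⟩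

theorem comp {p : β → Prop} (hp : SigmaOne p) {f : α → β} (hf : Primrec f) :
    SigmaOne fun a => p (f a) := by
  obtain ⟨r, hr, hpr⟩ := hp
  exact ⟨fun a n => r (f a) n, hr.comp (hf.comp Primrec.fst) Primrec.snd, fun a => hpr (f a)⟩

theorem and {p q : α → Prop} (hp : SigmaOne p) (hq : SigmaOne q) :
    SigmaOne fun a => p a ∧ q a := by
  obtain ⟨r, hr, hpr⟩ := hp
  obtain ⟨s, hs, hqs⟩ := hq
  refine ⟨fun a n => r a n.unpair.1 && s a n.unpair.2, ?_, fun a => ?_⟩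
  · have hu : Primrec fun x : α × ℕ => x.2.unpair := Primrec.unpair.comp Primrec.snd
    exact Primrec.and.comp (hr.comp Primrec.fst (Primrec.fst.comp hu))
      (hs.comp Primrec.fst (Primrec.snd.comp hu))
  · change p a ∧ q a ↔ _
    rw [hpr, hqs]
    constructor
    · rintro ⟨⟨m, hm⟩, n, hn⟩
      exact ⟨Nat.pair m n, by simp [hm, hn]⟩
    · rintro ⟨n, hn⟩
      rw [Bool.and_eq_true] at hn
      exact ⟨⟨_, hn.1⟩, _, hn.2⟩

theorem exists_of_prod {p : α × β → Prop} (hp : SigmaOne p) : SigmaOne fun a => ∃ b, p (a, b) := by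
  obtain ⟨r, hr, hpr⟩ := hp
  -- A witness pairs a code of `b` with a witness for `p (a, b)`; numbers whose first component
  -- decodes to nothing are rejected.
  refine ⟨fun a n => ((Encodable.decode (α := β) n.unpair.1).map
    fun b => r (a, b) n.unpair.2).getD false, ?_, fun a => ?_⟩
  · have hu : Primrec fun x : α × ℕ => x.2.unpair := Primrec.unpair.comp Primrec.snd
    refine Primrec.option_getD.comp (Primrec.option_map
      (Primrec.decode.comp (Primrec.fst.comp hu)) ?_) (Primrec.const false)
    exact hr.comp (Primrec.pair (Primrec.fst.comp Primrec.fst) Primrec.snd)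
      (Primrec.snd.comp (hu.comp Primrec.fst))
  · constructor
    · rintro ⟨b, hb⟩
      obtain ⟨n, hn⟩ := (hpr _).1 hb
      exact ⟨Nat.pair (Encodable.encode b) n, by simp [hn]⟩
    · rintro ⟨n, hn⟩
      cases hd : (Encodable.decode (α := β) n.unpair.1) with
      | none => simp [hd] at hn
      | some b => exact ⟨b, (hpr _).2 ⟨n.unpair.2, by simpa [hd] using hn⟩⟩

/-- Finitely many witnesses have a common strict bound `n`, and the search below `n` is primitive
recursive; `n` becomes the single witness. -/
theorem forall_mem {p : α × β → Prop} (hp : SigmaOne p) {f : α → List β} (hf : Primrec f) :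
    SigmaOne fun a => ∀ b ∈ f a, p (a, b) := by
  obtain ⟨r, hr, hpr⟩ := hp
  have h₁ : PrimrecPred fun x : ((α × ℕ) × β) × ℕ => r (x.1.1.1, x.1.2) x.2 = true :=
    Primrec.eq.comp (hr.comp
      (Primrec.pair (Primrec.fst.comp (Primrec.fst.comp Primrec.fst))
        (Primrec.snd.comp Primrec.fst)) Primrec.snd) (Primrec.const true)
  have h₂ := primrecPred_forall_mem
    (primrecPred_exists_lt h₁ (Primrec.snd.comp Primrec.fst)) (hf.comp Primrec.fst)
  obtain ⟨_, h₂⟩ := h₂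
  refine ⟨fun a n => decide (∀ b ∈ f a, ∃ m < n, r (a, b) m = true), h₂.of_eq fun x => ?_,
    fun a => ?_⟩
  · simp
  · simp only [decide_eq_true_eq]
    constructor
    · intro h
      have h' : ∀ b ∈ f a, ∃ m, r (a, b) m = true := fun b hb => (hpr _).1 (h b hb)
      generalize f a = l at h'
      induction l with
      | nil => exact ⟨0, by simp⟩
      | cons b l ih =>
        obtain ⟨n, hn⟩ := ih fun c hc => h' c (List.mem_cons_of_mem _ hc)
        obtain ⟨m, hm⟩ := h' b List.mem_cons_self
        refine ⟨max n (m + 1), fun c hc => ?_⟩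
        rcases List.mem_cons.1 hc with rfl | hc
        · exact ⟨m, by omega, hm⟩
        · obtain ⟨k, hk, hk'⟩ := hn c hc
          exact ⟨k, by omega, hk'⟩
    · rintro ⟨n, hn⟩ b hb
      obtain ⟨m, -, hm⟩ := hn b hb
      exact (hpr _).2 ⟨m, hm⟩

theorem forall_lt {p : α × ℕ → Prop} (hp : SigmaOne p) {f : α → ℕ} (hf : Primrec f) :
    SigmaOne fun a => ∀ b < f a, p (a, b) :=
  (hp.forall_mem (Primrec.list_range.comp hf)).of_eq fun a => by simp

theorem rePred {p : α → Prop} (hp : SigmaOne p) : REPred p := by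
  obtain ⟨r, hr, hpr⟩ := hp
  have h : Partrec fun a => Nat.rfind fun n => (Part.some (r a n) : Part Bool) :=
    Partrec.rfind hr.to_comp.partrec₂
  refine h.dom_re.of_eq fun a => ?_
  refine Nat.rfind_dom.trans ((hpr a).trans ?_).symm
  simp

/-- A nonempty projection of a primitive recursive relation is the range of a computable
sequence. -/
theorem exists_computable_range {p : α → Prop} (hp : SigmaOne p) (h : ∃ a, p a) :
    ∃ f : ℕ → α, Computable f ∧ Set.range f = {a | p a} := by
  obtain ⟨r, hr, hpr⟩ := hp
  obtain ⟨a₀, h₀⟩ := h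
  -- Numbers that code no verified witness are sent to `a₀`, which satisfies `p`; the sequence is
  -- total and leaves the set nowhere.
  refine ⟨fun n => ((Encodable.decode (α := α) n.unpair.1).map
    fun a => bif r a n.unpair.2 then a else a₀).getD a₀, Primrec.to_comp ?_, ?_⟩
  · refine Primrec.option_getD.comp (Primrec.option_map
      (Primrec.decode.comp (Primrec.fst.comp Primrec.unpair)) ?_) (Primrec.const a₀)
    exact Primrec.cond (hr.comp Primrec.snd (Primrec.snd.comp (Primrec.unpair.comp Primrec.fst)))
      Primrec.snd (Primrec.const a₀)
  · ext a
    constructor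
    · rintro ⟨n, rfl⟩
      cases hd : (Encodable.decode (α := α) n.unpair.1) with
      | none => simpa [hd] using h₀
      | some b =>
        cases hb : r b n.unpair.2 with
        | false => simpa [hd, hb] using h₀
        | true => simpa [hd, hb] using (hpr b).2 ⟨_, hb⟩
    · intro ha
      obtain ⟨n, hn⟩ := (hpr a).1 ha
      exact ⟨Nat.pair (Encodable.encode a) n, by simp [hn]⟩

end SigmaOne

end SigmaOne

/-! ### Presentations over the fixed alphabet `ℕ`, uniform in the number of generators. -/

section RawPresentations

/-- The data of a finite monoid presentation, without the condition on letters. -/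
abbrev RawPresentation : Type := ℕ × List (List ℕ × List ℕ)

/-- The relations of `p`, together with the relations `i = 1` for the letters `i` that are not
generators of `p`. -/
def IsRawRel (p : RawPresentation) (x : List ℕ × List ℕ) : Prop :=
  x ∈ p.2 ∨ (x.2 = [] ∧ x.1 = [x.1.headI] ∧ p.1 ≤ x.1.headI)

/-- The monoid presented by `p`, with all natural numbers as generators; those that are not
generators of `p` are trivial. -/
abbrev Raw (p : RawPresentation) : Type :=
  PresentedMonoid fun u v : FreeMonoid ℕ => IsRawRel p (u.toList, v.toList)

/-- The element of `Raw p` represented by a word. -/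
def Raw.word (p : RawPresentation) (w : List ℕ) : Raw p :=
  PresentedMonoid.mk _ (FreeMonoid.ofList w)

namespace Raw

variable {p q : RawPresentation}

theorem word_append (u v : List ℕ) : word p (u ++ v) = word p u * word p v := by
  simp [word, FreeMonoid.ofList_append]

theorem word_nil : word p [] = 1 := rfl

theorem word_surjective (x : Raw p) : ∃ w, word p w = x := by
  obtain ⟨w, rfl⟩ := PresentedMonoid.surjective_mk x
  exact ⟨w.toList, by simp [word]⟩

theorem word_eq_of_isRawRel {x : List ℕ × List ℕ} (h : IsRawRel p x) :
    word p x.1 = word p x.2 :=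
  PresentedMonoid.mk_eq_mk_of_rel (by simpa using h)

theorem word_eq_one_of_le {i : ℕ} (h : p.1 ≤ i) : word p [i] = 1 :=
  word_eq_of_isRawRel (x := ([i], [])) (Or.inr (by simpa using h))

theorem word_eq_prod (w : List ℕ) : word p w = (w.map fun i => word p [i]).prod := by
  induction w with
  | nil => rfl
  | cons a w ih => rw [List.map_cons, List.prod_cons, ← ih, ← word_append]; rfl

theorem exists_hom {N : Type*} [Monoid N] (f : ℕ → N) (h₁ : ∀ i, p.1 ≤ i → f i = 1)
    (h₂ : ∀ x ∈ p.2, (x.1.map f).prod = (x.2.map f).prod) :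
    ∃ φ : Raw p →* N, ∀ w, φ (word p w) = (w.map f).prod := by
  refine ⟨PresentedMonoid.lift f ?_, fun w => ?_⟩
  · rintro a b (hab | ⟨hb, ha, hp⟩)
    · simpa [FreeMonoid.lift_apply] using h₂ _ hab
    · dsimp only at hb ha hp
      rw [FreeMonoid.lift_apply, FreeMonoid.lift_apply, hb, ha]
      simp [h₁ _ hp]
  · change FreeMonoid.lift f (FreeMonoid.ofList w) = _
    simp [FreeMonoid.lift_apply]

theorem hom_ext {N : Type*} [Monoid N] {φ ψ : Raw p →* N}
    (h : ∀ i < p.1, φ (word p [i]) = ψ (word p [i])) : φ = ψ := by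
  refine PresentedMonoid.ext _ fun i => ?_
  change φ (word p [i]) = ψ (word p [i])
  by_cases hi : i < p.1
  · exact h i hi
  · rw [word_eq_one_of_le (not_lt.1 hi), map_one, map_one]

/-! ### Derivations as witnesses of equality of words. -/

section WordProblem

open Classical in
/-- Apply the relation `m.2` in the context `m.1`, in either direction, to the word `w`, if
possible. -/
noncomputable def applyMove (p : RawPresentation) (w : List ℕ)
    (m : (List ℕ × List ℕ) × (List ℕ × List ℕ)) : List ℕ :=
  if w = m.1.1 ++ m.2.1 ++ m.1.2 ∧ (IsRawRel p m.2 ∨ IsRawRel p m.2.swap) then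
    m.1.1 ++ m.2.2 ++ m.1.2 else w

theorem word_applyMove (w : List ℕ) (m : (List ℕ × List ℕ) × (List ℕ × List ℕ)) :
    word p (applyMove p w m) = word p w := by
  rw [applyMove]
  split_ifs with h
  · obtain ⟨rfl, h⟩ := h
    have : word p m.2.1 = word p m.2.2 := by
      rcases h with h | h
      · exact word_eq_of_isRawRel h
      · exact (word_eq_of_isRawRel h).symm
    simp only [word_append, this]
  · rfl

/-- `v` is obtained from `u` by a list of moves. -/
def Reach (p : RawPresentation) (u v : List ℕ) : Prop :=
  ∃ D : List ((List ℕ × List ℕ) × (List ℕ × List ℕ)), D.foldl (applyMove p) u = v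

theorem Reach.refl (u : List ℕ) : Reach p u u := ⟨[], rfl⟩

theorem Reach.trans {u v w : List ℕ} (h₁ : Reach p u v) (h₂ : Reach p v w) : Reach p u w := by
  obtain ⟨D, rfl⟩ := h₁
  obtain ⟨E, rfl⟩ := h₂
  exact ⟨D ++ E, List.foldl_append⟩

theorem reach_of_rel (a b : List ℕ) {x : List ℕ × List ℕ}
    (h : IsRawRel p x ∨ IsRawRel p x.swap) : Reach p (a ++ x.1 ++ b) (a ++ x.2 ++ b) :=
  ⟨[((a, b), x)], by
    rw [List.foldl_cons, List.foldl_nil, applyMove, if_pos ⟨rfl, h⟩]⟩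

/-- A move is undone by swapping its relation, which is why moves accept relations in both
directions. -/
theorem reach_context_applyMove (a b u : List ℕ) (m : (List ℕ × List ℕ) × (List ℕ × List ℕ)) :
    Reach p (a ++ u ++ b) (a ++ applyMove p u m ++ b) ∧
      Reach p (a ++ applyMove p u m ++ b) (a ++ u ++ b) := by
  rw [applyMove]
  split_ifs with h
  · obtain ⟨rfl, h⟩ := h
    constructor
    · simpa using reach_of_rel (a ++ m.1.1) (m.1.2 ++ b) h
    · simpa using reach_of_rel (a ++ m.1.1) (m.1.2 ++ b) (x := m.2.swap)
        (by simpa using h.symm)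
  · exact ⟨Reach.refl _, Reach.refl _⟩

/-- Empty contexts give the symmetry of `Reach`, general ones its compatibility with products. -/
theorem Reach.context {u v : List ℕ} (h : Reach p u v) (a b : List ℕ) :
    Reach p (a ++ u ++ b) (a ++ v ++ b) ∧ Reach p (a ++ v ++ b) (a ++ u ++ b) := by
  obtain ⟨D, rfl⟩ := h
  induction D generalizing u with
  | nil => exact ⟨Reach.refl _, Reach.refl _⟩
  | cons m D ih =>
    have h₁ := reach_context_applyMove (p := p) a b u m
    have h₂ := ih (u := applyMove p u m)
    exact ⟨h₁.1.trans h₂.1, h₂.2.trans h₁.2⟩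

/-- `Reach` as a congruence on the free monoid. -/
def reachCon (p : RawPresentation) : Con (FreeMonoid ℕ) where
  r u v := Reach p u.toList v.toList
  iseqv :=
    { refl := fun _ => Reach.refl _
      symm := fun h => by simpa using (h.context [] []).2
      trans := fun h₁ h₂ => h₁.trans h₂ }
  mul' := by
    intro u u' v v' hu hv
    have h₁ := (hu.context [] v.toList).1
    have h₂ := (hv.context u'.toList []).1
    simp only [List.nil_append, List.append_nil] at h₁ h₂
    exact h₁.trans h₂

/-- The congruence generated by the relations lies in `reachCon p`, since each relation is a single
move; conversely no move changes the element represented. -/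
theorem word_eq_iff_reach {u v : List ℕ} : word p u = word p v ↔ Reach p u v := by
  constructor
  · intro h
    have hle : conGen (fun u v : FreeMonoid ℕ => IsRawRel p (u.toList, v.toList)) ≤ reachCon p :=
      Con.conGen_le.2 fun a b hab => by
        have := reach_of_rel (p := p) [] [] (Or.inl hab)
        rw [List.nil_append, List.nil_append, List.append_nil, List.append_nil] at this
        exact this
    exact hle (PresentedMonoid.mk_eq_mk_iff.1 h)
  · rintro ⟨D, rfl⟩
    induction D generalizing u with
    | nil => rfl
    | cons m D ih => rw [List.foldl_cons, ← ih, word_applyMove]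

theorem primrecPred_isRawRel :
    PrimrecPred fun x : RawPresentation × (List ℕ × List ℕ) => IsRawRel x.1 x.2 := by
  have h₁ : Primrec fun x : RawPresentation × (List ℕ × List ℕ) => x.2.1 :=
    Primrec.fst.comp Primrec.snd
  have h₂ : Primrec fun x : RawPresentation × (List ℕ × List ℕ) => x.2.1.headI :=
    Primrec.list_headI.comp h₁
  refine (primrecPred_mem Primrec.snd (Primrec.snd.comp Primrec.fst)).or
    ((Primrec.eq.comp (Primrec.snd.comp Primrec.snd) (Primrec.const [])).and
      ((Primrec.eq.comp h₁ (Primrec.list_cons.comp h₂ (Primrec.const []))).and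
        (Primrec.nat_le.comp (Primrec.fst.comp Primrec.fst) h₂)))

open Classical in
theorem primrec_applyMove : Primrec fun x : RawPresentation ×
    (List ℕ × ((List ℕ × List ℕ) × (List ℕ × List ℕ))) => applyMove x.1 x.2.1 x.2.2 := by
  have hm : Primrec fun x : RawPresentation ×
      (List ℕ × ((List ℕ × List ℕ) × (List ℕ × List ℕ))) => x.2.2 :=
    Primrec.snd.comp Primrec.snd
  have ha := Primrec.fst.comp (Primrec.fst.comp hm)
  have hb := Primrec.snd.comp (Primrec.fst.comp hm)
  have hl := Primrec.fst.comp (Primrec.snd.comp hm)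
  have hr := Primrec.snd.comp (Primrec.snd.comp hm)
  refine Primrec.ite ?_ (Primrec.list_append.comp (Primrec.list_append.comp ha hr) hb)
    (Primrec.fst.comp Primrec.snd)
  refine (Primrec.eq.comp (Primrec.fst.comp Primrec.snd)
    (Primrec.list_append.comp (Primrec.list_append.comp ha hl) hb)).and
    ((primrecPred_isRawRel.comp (Primrec.pair Primrec.fst (Primrec.snd.comp hm))).or
      (primrecPred_isRawRel.comp (Primrec.pair Primrec.fst (Primrec.pair hr hl))))

/-- The word problem of finite monoid presentations. -/
theorem sigmaOne_word_eq : SigmaOne fun x : RawPresentation × (List ℕ × List ℕ) =>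
    word x.1 x.2.1 = word x.1 x.2.2 := by
  have h₁ : Primrec₂ fun (x : (RawPresentation × (List ℕ × List ℕ)) ×
      List ((List ℕ × List ℕ) × (List ℕ × List ℕ)))
      (y : List ℕ × ((List ℕ × List ℕ) × (List ℕ × List ℕ))) => applyMove x.1.1 y.1 y.2 :=
    primrec_applyMove.comp (Primrec.pair
      (Primrec.fst.comp (Primrec.fst.comp Primrec.fst)) Primrec.snd)
  have h₂ : Primrec fun x : (RawPresentation × (List ℕ × List ℕ)) ×
      List ((List ℕ × List ℕ) × (List ℕ × List ℕ)) =>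
      x.2.foldl (fun w m => applyMove x.1.1 w m) x.1.2.1 :=
    Primrec.list_foldl Primrec.snd (Primrec.fst.comp (Primrec.snd.comp Primrec.fst)) h₁
  have h : PrimrecPred fun x : (RawPresentation × (List ℕ × List ℕ)) ×
      List ((List ℕ × List ℕ) × (List ℕ × List ℕ)) =>
      x.2.foldl (fun w m => applyMove x.1.1 w m) x.1.2.1 = x.1.2.2 :=
    Primrec.eq.comp h₂ (Primrec.snd.comp (Primrec.snd.comp Primrec.fst))
  exact (SigmaOne.of_primrecPred h).exists_of_prod.of_eq fun x =>
    (word_eq_iff_reach (p := x.1) (u := x.2.1) (v := x.2.2)).symm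

end WordProblem

/-! ### Images of generators as witnesses of isomorphism. -/

section Isomorphisms

/-- Substitute the words of a list for the letters of a word. -/
def subst (V : List (List ℕ)) (w : List ℕ) : List ℕ := w.flatMap fun i => V.getD i []

/-- The words of the list `V` define a homomorphism from `Raw p` to `Raw q`. -/
def IsHomCert (p q : RawPresentation) (V : List (List ℕ)) : Prop :=
  V.length ≤ p.1 ∧ ∀ x ∈ p.2, word q (subst V x.1) = word q (subst V x.2)

theorem word_subst (V : List (List ℕ)) (w : List ℕ) :
    word q (subst V w) = (w.map fun i => word q (V.getD i [])).prod := by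
  induction w with
  | nil => rfl
  | cons a w ih => rw [List.map_cons, List.prod_cons, ← ih, ← word_append]; rfl

theorem IsHomCert.exists_hom {V : List (List ℕ)} (h : IsHomCert p q V) :
    ∃ φ : Raw p →* Raw q, ∀ w, φ (word p w) = word q (subst V w) := by
  obtain ⟨φ, hφ⟩ := Raw.exists_hom (p := p) (fun i => word q (V.getD i []))
    -- Letters beyond the list are read as the empty word; the bound on `V.length` ensures that
    -- non-generators go to `1`.
    (fun i hi => by rw [List.getD_eq_default _ _ (h.1.trans hi), word_nil])
    (fun x hx => by rw [← word_subst, ← word_subst, h.2 x hx])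
  exact ⟨φ, fun w => by rw [hφ, word_subst]⟩

theorem exists_isHomCert (φ : Raw p →* Raw q) :
    ∃ V, IsHomCert p q V ∧ ∀ w, φ (word p w) = word q (subst V w) := by
  choose f hf using fun i => word_surjective (φ (word p [i]))
  let V := (List.range p.1).map f
  have hV : ∀ i, word q (V.getD i []) = φ (word p [i]) := fun i => by
    by_cases hi : i < p.1
    · rw [List.getD_eq_getElem _ _ (by simpa [V] using hi)]
      simp [V, hf]
    · rw [List.getD_eq_default _ _ (by simpa [V] using hi), word_nil,
        word_eq_one_of_le (not_lt.1 hi), map_one]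
  have key : ∀ w, φ (word p w) = word q (subst V w) := fun w => by
    rw [word_subst, word_eq_prod, map_list_prod, List.map_map]
    simp only [hV, Function.comp_def]
  exact ⟨V, ⟨by simp [V], fun x hx => by rw [← key, ← key, word_eq_of_isRawRel (Or.inl hx)]⟩, key⟩

/-- A homomorphism is given by the images of the generators, so an isomorphism is a finite datum
whose correctness is a finite list of equalities of words. -/
theorem nonempty_mulEquiv_iff : Nonempty (Raw p ≃* Raw q) ↔ ∃ VW : List (List ℕ) × List (List ℕ),
    (IsHomCert p q VW.1 ∧ IsHomCert q p VW.2) ∧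
    (∀ i < p.1, word p (subst VW.2 (subst VW.1 [i])) = word p [i]) ∧
    (∀ i < q.1, word q (subst VW.1 (subst VW.2 [i])) = word q [i]) := by
  constructor
  · rintro ⟨E⟩
    obtain ⟨V, hV, hV'⟩ := exists_isHomCert E.toMonoidHom
    obtain ⟨W, hW, hW'⟩ := exists_isHomCert E.symm.toMonoidHom
    refine ⟨(V, W), ⟨hV, hW⟩, fun i _ => ?_, fun i _ => ?_⟩
    · rw [← hW', ← hV']
      simp
    · rw [← hV', ← hW']
      simp
  · rintro ⟨⟨V, W⟩, ⟨hV, hW⟩, h₁, h₂⟩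
    obtain ⟨φ, hφ⟩ := hV.exists_hom
    obtain ⟨ψ, hψ⟩ := hW.exists_hom
    refine ⟨MonoidHom.toMulEquiv φ ψ (hom_ext fun i hi => ?_) (hom_ext fun i hi => ?_)⟩
    · simpa [hφ, hψ] using h₁ i hi
    · simpa [hφ, hψ] using h₂ i hi

theorem primrec_subst : Primrec₂ subst :=
  Primrec.list_flatMap Primrec.snd
    ((Primrec.list_getD []).comp (Primrec.fst.comp Primrec.fst) Primrec.snd)

theorem sigmaOne_isHomCert : SigmaOne fun x : (RawPresentation × RawPresentation) ×
    List (List ℕ) => IsHomCert x.1.1 x.1.2 x.2 := by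
  refine (SigmaOne.of_primrecPred (Primrec.nat_le.comp (Primrec.list_length.comp Primrec.snd)
    (Primrec.fst.comp (Primrec.fst.comp Primrec.fst)))).and ?_
  refine SigmaOne.forall_mem (p := fun y : ((RawPresentation × RawPresentation) ×
    List (List ℕ)) × (List ℕ × List ℕ) =>
      word y.1.1.2 (subst y.1.2 y.2.1) = word y.1.1.2 (subst y.1.2 y.2.2)) ?_
    (Primrec.snd.comp (Primrec.fst.comp Primrec.fst))
  have hV := Primrec.snd.comp (Primrec.fst (α := (RawPresentation × RawPresentation) ×
    List (List ℕ)) (β := List ℕ × List ℕ))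
  exact sigmaOne_word_eq.comp (Primrec.pair
    (Primrec.snd.comp (Primrec.fst.comp Primrec.fst))
    (Primrec.pair (primrec_subst.comp hV (Primrec.fst.comp Primrec.snd))
      (primrec_subst.comp hV (Primrec.snd.comp Primrec.snd))))

theorem sigmaOne_isInverseCert : SigmaOne fun x : RawPresentation ×
    (List (List ℕ) × List (List ℕ)) =>
      ∀ i < x.1.1, word x.1 (subst x.2.2 (subst x.2.1 [i])) = word x.1 [i] := by
  refine SigmaOne.forall_lt (p := fun y : (RawPresentation × (List (List ℕ) × List (List ℕ))) × ℕ =>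
    word y.1.1 (subst y.1.2.2 (subst y.1.2.1 [y.2])) = word y.1.1 [y.2]) ?_
    (Primrec.fst.comp Primrec.fst)
  have hi : Primrec fun y : (RawPresentation × (List (List ℕ) × List (List ℕ))) × ℕ => [y.2] :=
    Primrec.list_cons.comp Primrec.snd (Primrec.const [])
  have hVW := Primrec.snd.comp (Primrec.fst (α := RawPresentation ×
    (List (List ℕ) × List (List ℕ))) (β := ℕ))
  exact sigmaOne_word_eq.comp (Primrec.pair (Primrec.fst.comp Primrec.fst)
    (Primrec.pair (primrec_subst.comp (Primrec.snd.comp hVW)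
      (primrec_subst.comp (Primrec.fst.comp hVW) hi)) hi))

/-- The isomorphism problem of finite monoid presentations. -/
theorem sigmaOne_mulEquiv : SigmaOne fun x : RawPresentation × RawPresentation =>
    Nonempty (Raw x.1 ≃* Raw x.2) := by
  have hVW := Primrec.snd (α := RawPresentation × RawPresentation)
    (β := List (List ℕ) × List (List ℕ))
  have hpq := Primrec.fst (α := RawPresentation × RawPresentation)
    (β := List (List ℕ) × List (List ℕ))
  have hp := Primrec.fst.comp hpq
  have hq := Primrec.snd.comp hpq
  have hV := Primrec.fst.comp hVW
  have hW := Primrec.snd.comp hVW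
  have h := ((sigmaOne_isHomCert.comp (Primrec.pair hpq hV)).and
    (sigmaOne_isHomCert.comp (Primrec.pair (Primrec.pair hq hp) hW))).and
    ((sigmaOne_isInverseCert.comp (Primrec.pair hp hVW)).and
      (sigmaOne_isInverseCert.comp (Primrec.pair hq (Primrec.pair hW hV))))
  exact h.exists_of_prod.of_eq fun x => (nonempty_mulEquiv_iff (p := x.1) (q := x.2)).symm

end Isomorphisms

end Raw

end RawPresentations

/-! ### Germ certificates and their primitive recursive verification. -/

section Certificates

/-- An entry of a table of natural numbers. -/
def tableEntry (T : List (List ℕ)) (s t : ℕ) : ℕ := (T.getD s []).getD t 0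

/-- On the letters below `n`, the table `T` is a right complement with neutral letter `e` such
that all letters divide `Δ`. -/
def IsComplTable (n : ℕ) (T : List (List ℕ)) (e Δ : ℕ) : Prop :=
  (∀ s < n, (tableEntry T s s = e ∧ tableEntry T e s = s) ∧
    (tableEntry T s e = e ∧ tableEntry T Δ s = e)) ∧
  (∀ s < n, ∀ t < n, tableEntry T s t < n) ∧
  (∀ s < n, ∀ t < n, ∀ r < n, tableEntry T (tableEntry T s t) (tableEntry T s r) =
    tableEntry T (tableEntry T t s) (tableEntry T t r))

/-- A finite monoid presentation, the tables of a right complement and of a left complement on its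
generators, a neutral letter and a letter for a Garside element. -/
abbrev GermCert : Type :=
  RawPresentation × ((List (List ℕ) × List (List ℕ)) × (ℕ × ℕ))

namespace GermCert

variable (c : GermCert)

/-- The right complement. -/
def rc (s t : ℕ) : ℕ := tableEntry c.2.1.1 s t

/-- The left complement. -/
def lc (s t : ℕ) : ℕ := tableEntry c.2.1.2 s t

/-- The neutral letter. -/
def neutral : ℕ := c.2.2.1

/-- The letter for the Garside element. -/
def top : ℕ := c.2.2.2

/-- The relations of the certificate are `e = 1` and relations `s * t = r` that are compatible with
both complements. -/
def RelsSound : Prop :=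
  ∀ x ∈ c.1.2, x = ([c.neutral], []) ∨ ∃ s < c.1.1, ∃ t < c.1.1, ∃ r < c.1.1, x = ([s, t], [r]) ∧
    (c.rc r s = c.neutral ∧ c.rc s r = t) ∧ (c.lc r t = c.neutral ∧ c.lc t r = s)

/-- The relations of the certificate contain those of both complements. -/
def RelsComplete : Prop :=
  ∀ s < c.1.1, ∀ t < c.1.1,
    (∃ r < c.1.1, ([s, c.rc s t], [r]) ∈ c.1.2 ∧ ([t, c.rc t s], [r]) ∈ c.1.2) ∧
    (∃ r < c.1.1, ([c.lc s t, s], [r]) ∈ c.1.2 ∧ ([c.lc t s, t], [r]) ∈ c.1.2)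

/-- The certificate describes the germ of a Garside monoid. -/
def IsGood : Prop :=
  ((c.neutral < c.1.1 ∧ c.top < c.1.1) ∧ ([c.neutral], []) ∈ c.1.2) ∧
  (IsComplTable c.1.1 c.2.1.1 c.neutral c.top ∧ IsComplTable c.1.1 c.2.1.2 c.neutral c.top) ∧
  (c.RelsSound ∧ c.RelsComplete)

section Primrec

variable {α : Type*} [Primcodable α]

theorem primrec_tableEntry {T : α → List (List ℕ)} {s t : α → ℕ} (hT : Primrec T)
    (hs : Primrec s) (ht : Primrec t) : Primrec fun a => tableEntry (T a) (s a) (t a) :=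
  (Primrec.list_getD 0).comp ((Primrec.list_getD []).comp hT hs) ht

theorem primrec_singleton {s : α → ℕ} (hs : Primrec s) : Primrec fun a => [s a] :=
  Primrec.list_cons.comp hs (Primrec.const [])

theorem primrec_relation {s t r : α → ℕ} (hs : Primrec s) (ht : Primrec t) (hr : Primrec r) :
    Primrec fun a => (([s a, t a], [r a]) : List ℕ × List ℕ) :=
  Primrec.pair (Primrec.list_cons.comp hs (primrec_singleton ht)) (primrec_singleton hr)

theorem primrecPred_isComplTable {n : α → ℕ} {T : α → List (List ℕ)} {e Δ : α → ℕ}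
    (hn : Primrec n) (hT : Primrec T) (he : Primrec e) (hΔ : Primrec Δ) :
    PrimrecPred fun a => IsComplTable (n a) (T a) (e a) (Δ a) := by
  -- The index counts the quantifiers already opened: `f` projects to the parameter, and `s`, `t`,
  -- `r` to the quantified letters.
  have f₁ : Primrec fun x : α × ℕ => x.1 := Primrec.fst
  have f₂ : Primrec fun x : (α × ℕ) × ℕ => x.1.1 := f₁.comp Primrec.fst
  have f₃ : Primrec fun x : ((α × ℕ) × ℕ) × ℕ => x.1.1.1 := f₂.comp Primrec.fst
  have s₁ : Primrec fun x : α × ℕ => x.2 := Primrec.snd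
  have s₂ : Primrec fun x : (α × ℕ) × ℕ => x.1.2 := s₁.comp Primrec.fst
  have t₂ : Primrec fun x : (α × ℕ) × ℕ => x.2 := Primrec.snd
  have s₃ : Primrec fun x : ((α × ℕ) × ℕ) × ℕ => x.1.1.2 := s₂.comp Primrec.fst
  have t₃ : Primrec fun x : ((α × ℕ) × ℕ) × ℕ => x.1.2 := t₂.comp Primrec.fst
  have r₃ : Primrec fun x : ((α × ℕ) × ℕ) × ℕ => x.2 := Primrec.snd
  have T₁ := hT.comp f₁
  have T₂ := hT.comp f₂
  have T₃ := hT.comp f₃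
  refine PrimrecPred.and ?_ (PrimrecPred.and ?_ ?_)
  · refine primrecPred_forall_lt (p := fun x : α × ℕ =>
      (tableEntry (T x.1) x.2 x.2 = e x.1 ∧ tableEntry (T x.1) (e x.1) x.2 = x.2) ∧
        (tableEntry (T x.1) x.2 (e x.1) = e x.1 ∧ tableEntry (T x.1) (Δ x.1) x.2 = e x.1)) ?_ hn
    have e₁ := he.comp f₁
    exact ((Primrec.eq.comp (primrec_tableEntry T₁ s₁ s₁) e₁).and
      (Primrec.eq.comp (primrec_tableEntry T₁ e₁ s₁) s₁)).and
      ((Primrec.eq.comp (primrec_tableEntry T₁ s₁ e₁) e₁).and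
      (Primrec.eq.comp (primrec_tableEntry T₁ (hΔ.comp f₁) s₁) e₁))
  · refine primrecPred_forall_lt (p := fun x : α × ℕ =>
      ∀ t < n x.1, tableEntry (T x.1) x.2 t < n x.1) ?_ hn
    refine primrecPred_forall_lt (p := fun x : (α × ℕ) × ℕ =>
      tableEntry (T x.1.1) x.1.2 x.2 < n x.1.1) ?_ (hn.comp f₁)
    exact Primrec.nat_lt.comp (primrec_tableEntry T₂ s₂ t₂) (hn.comp f₂)
  · refine primrecPred_forall_lt (p := fun x : α × ℕ => ∀ t < n x.1, ∀ r < n x.1,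
      tableEntry (T x.1) (tableEntry (T x.1) x.2 t) (tableEntry (T x.1) x.2 r) =
        tableEntry (T x.1) (tableEntry (T x.1) t x.2) (tableEntry (T x.1) t r)) ?_ hn
    refine primrecPred_forall_lt (p := fun x : (α × ℕ) × ℕ => ∀ r < n x.1.1,
      tableEntry (T x.1.1) (tableEntry (T x.1.1) x.1.2 x.2) (tableEntry (T x.1.1) x.1.2 r) =
        tableEntry (T x.1.1) (tableEntry (T x.1.1) x.2 x.1.2) (tableEntry (T x.1.1) x.2 r)) ?_
      (hn.comp f₁)
    refine primrecPred_forall_lt (p := fun x : ((α × ℕ) × ℕ) × ℕ =>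
      tableEntry (T x.1.1.1) (tableEntry (T x.1.1.1) x.1.1.2 x.1.2)
        (tableEntry (T x.1.1.1) x.1.1.2 x.2) =
      tableEntry (T x.1.1.1) (tableEntry (T x.1.1.1) x.1.2 x.1.1.2)
        (tableEntry (T x.1.1.1) x.1.2 x.2)) ?_ (hn.comp f₂)
    exact Primrec.eq.comp
      (primrec_tableEntry T₃ (primrec_tableEntry T₃ s₃ t₃) (primrec_tableEntry T₃ s₃ r₃))
      (primrec_tableEntry T₃ (primrec_tableEntry T₃ t₃ s₃) (primrec_tableEntry T₃ t₃ r₃))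

theorem primrec_numGens : Primrec fun c : GermCert => c.1.1 := Primrec.fst.comp Primrec.fst

theorem primrec_relations : Primrec fun c : GermCert => c.1.2 := Primrec.snd.comp Primrec.fst

theorem primrec_neutral : Primrec neutral := Primrec.fst.comp (Primrec.snd.comp Primrec.snd)

theorem primrec_top : Primrec top := Primrec.snd.comp (Primrec.snd.comp Primrec.snd)

theorem primrec_rc {c : α → GermCert} {s t : α → ℕ} (hc : Primrec c) (hs : Primrec s)
    (ht : Primrec t) : Primrec fun a => (c a).rc (s a) (t a) :=
  primrec_tableEntry (Primrec.fst.comp (Primrec.fst.comp (Primrec.snd.comp hc))) hs ht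

theorem primrec_lc {c : α → GermCert} {s t : α → ℕ} (hc : Primrec c) (hs : Primrec s)
    (ht : Primrec t) : Primrec fun a => (c a).lc (s a) (t a) :=
  primrec_tableEntry (Primrec.snd.comp (Primrec.fst.comp (Primrec.snd.comp hc))) hs ht

theorem primrecPred_relsSound : PrimrecPred RelsSound := by
  have f₁ : Primrec fun x : (GermCert × (List ℕ × List ℕ)) × ℕ => x.1.1 :=
    Primrec.fst.comp Primrec.fst
  have f₂ : Primrec fun x : ((GermCert × (List ℕ × List ℕ)) × ℕ) × ℕ => x.1.1.1 :=
    f₁.comp Primrec.fst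
  have f₃ : Primrec fun x : (((GermCert × (List ℕ × List ℕ)) × ℕ) × ℕ) × ℕ => x.1.1.1.1 :=
    f₂.comp Primrec.fst
  have x₃ : Primrec fun x : (((GermCert × (List ℕ × List ℕ)) × ℕ) × ℕ) × ℕ => x.1.1.1.2 :=
    Primrec.snd.comp (Primrec.fst.comp (Primrec.fst.comp Primrec.fst))
  have s₃ : Primrec fun x : (((GermCert × (List ℕ × List ℕ)) × ℕ) × ℕ) × ℕ => x.1.1.2 :=
    Primrec.snd.comp (Primrec.fst.comp Primrec.fst)
  have t₃ : Primrec fun x : (((GermCert × (List ℕ × List ℕ)) × ℕ) × ℕ) × ℕ => x.1.2 :=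
    Primrec.snd.comp Primrec.fst
  have r₃ : Primrec fun x : (((GermCert × (List ℕ × List ℕ)) × ℕ) × ℕ) × ℕ => x.2 :=
    Primrec.snd
  have e₃ := primrec_neutral.comp f₃
  refine primrecPred_forall_mem (p := fun x : GermCert × (List ℕ × List ℕ) =>
    x.2 = ([x.1.neutral], []) ∨ ∃ s < x.1.1.1, ∃ t < x.1.1.1, ∃ r < x.1.1.1, x.2 = ([s, t], [r]) ∧
      (x.1.rc r s = x.1.neutral ∧ x.1.rc s r = t) ∧
      (x.1.lc r t = x.1.neutral ∧ x.1.lc t r = s)) ?_ primrec_relations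
  refine PrimrecPred.or (Primrec.eq.comp Primrec.snd (Primrec.pair
    (primrec_singleton (primrec_neutral.comp Primrec.fst)) (Primrec.const []))) ?_
  refine primrecPred_exists_lt (p := fun y : (GermCert × (List ℕ × List ℕ)) × ℕ =>
    ∃ t < y.1.1.1.1, ∃ r < y.1.1.1.1, y.1.2 = ([y.2, t], [r]) ∧
      (y.1.1.rc r y.2 = y.1.1.neutral ∧ y.1.1.rc y.2 r = t) ∧
      (y.1.1.lc r t = y.1.1.neutral ∧ y.1.1.lc t r = y.2)) ?_ (primrec_numGens.comp Primrec.fst)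
  refine primrecPred_exists_lt (p := fun y : ((GermCert × (List ℕ × List ℕ)) × ℕ) × ℕ =>
    ∃ r < y.1.1.1.1.1, y.1.1.2 = ([y.1.2, y.2], [r]) ∧
      (y.1.1.1.rc r y.1.2 = y.1.1.1.neutral ∧ y.1.1.1.rc y.1.2 r = y.2) ∧
      (y.1.1.1.lc r y.2 = y.1.1.1.neutral ∧ y.1.1.1.lc y.2 r = y.1.2)) ?_
    (primrec_numGens.comp f₁)
  refine primrecPred_exists_lt (p := fun y : (((GermCert × (List ℕ × List ℕ)) × ℕ) × ℕ) × ℕ =>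
    y.1.1.1.2 = ([y.1.1.2, y.1.2], [y.2]) ∧
      (y.1.1.1.1.rc y.2 y.1.1.2 = y.1.1.1.1.neutral ∧ y.1.1.1.1.rc y.1.1.2 y.2 = y.1.2) ∧
      (y.1.1.1.1.lc y.2 y.1.2 = y.1.1.1.1.neutral ∧ y.1.1.1.1.lc y.1.2 y.2 = y.1.1.2)) ?_
    (primrec_numGens.comp f₂)
  exact (Primrec.eq.comp x₃ (primrec_relation s₃ t₃ r₃)).and
    (((Primrec.eq.comp (primrec_rc f₃ r₃ s₃) e₃).and (Primrec.eq.comp (primrec_rc f₃ s₃ r₃) t₃)).and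
    ((Primrec.eq.comp (primrec_lc f₃ r₃ t₃) e₃).and (Primrec.eq.comp (primrec_lc f₃ t₃ r₃) s₃)))

theorem primrecPred_relsComplete : PrimrecPred RelsComplete := by
  have f₁ : Primrec fun x : GermCert × ℕ => x.1 := Primrec.fst
  have f₂ : Primrec fun x : (GermCert × ℕ) × ℕ => x.1.1 := f₁.comp Primrec.fst
  have f₃ : Primrec fun x : ((GermCert × ℕ) × ℕ) × ℕ => x.1.1.1 := f₂.comp Primrec.fst
  have s₃ : Primrec fun x : ((GermCert × ℕ) × ℕ) × ℕ => x.1.1.2 :=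
    Primrec.snd.comp (Primrec.fst.comp Primrec.fst)
  have t₃ : Primrec fun x : ((GermCert × ℕ) × ℕ) × ℕ => x.1.2 := Primrec.snd.comp Primrec.fst
  have r₃ : Primrec fun x : ((GermCert × ℕ) × ℕ) × ℕ => x.2 := Primrec.snd
  have R₃ := primrec_relations.comp f₃
  refine primrecPred_forall_lt (p := fun x : GermCert × ℕ => ∀ t < x.1.1.1,
    (∃ r < x.1.1.1, ([x.2, x.1.rc x.2 t], [r]) ∈ x.1.1.2 ∧ ([t, x.1.rc t x.2], [r]) ∈ x.1.1.2) ∧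
    (∃ r < x.1.1.1, ([x.1.lc x.2 t, x.2], [r]) ∈ x.1.1.2 ∧ ([x.1.lc t x.2, t], [r]) ∈ x.1.1.2))
    ?_ primrec_numGens
  refine primrecPred_forall_lt (p := fun x : (GermCert × ℕ) × ℕ =>
    (∃ r < x.1.1.1.1, ([x.1.2, x.1.1.rc x.1.2 x.2], [r]) ∈ x.1.1.1.2 ∧
      ([x.2, x.1.1.rc x.2 x.1.2], [r]) ∈ x.1.1.1.2) ∧
    (∃ r < x.1.1.1.1, ([x.1.1.lc x.1.2 x.2, x.1.2], [r]) ∈ x.1.1.1.2 ∧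
      ([x.1.1.lc x.2 x.1.2, x.2], [r]) ∈ x.1.1.1.2)) ?_ (primrec_numGens.comp f₁)
  refine PrimrecPred.and ?_ ?_
  · refine primrecPred_exists_lt (p := fun x : ((GermCert × ℕ) × ℕ) × ℕ =>
      ([x.1.1.2, x.1.1.1.rc x.1.1.2 x.1.2], [x.2]) ∈ x.1.1.1.1.2 ∧
      ([x.1.2, x.1.1.1.rc x.1.2 x.1.1.2], [x.2]) ∈ x.1.1.1.1.2) ?_ (primrec_numGens.comp f₂)
    exact (primrecPred_mem (primrec_relation s₃ (primrec_rc f₃ s₃ t₃) r₃) R₃).and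
      (primrecPred_mem (primrec_relation t₃ (primrec_rc f₃ t₃ s₃) r₃) R₃)
  · refine primrecPred_exists_lt (p := fun x : ((GermCert × ℕ) × ℕ) × ℕ =>
      ([x.1.1.1.lc x.1.1.2 x.1.2, x.1.1.2], [x.2]) ∈ x.1.1.1.1.2 ∧
      ([x.1.1.1.lc x.1.2 x.1.1.2, x.1.2], [x.2]) ∈ x.1.1.1.1.2) ?_ (primrec_numGens.comp f₂)
    exact (primrecPred_mem (primrec_relation (primrec_lc f₃ s₃ t₃) s₃ r₃) R₃).and
      (primrecPred_mem (primrec_relation (primrec_lc f₃ t₃ s₃) t₃ r₃) R₃)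

theorem primrecPred_isGood : PrimrecPred IsGood := by
  have hT := Primrec.fst.comp (Primrec.snd (α := RawPresentation)
    (β := (List (List ℕ) × List (List ℕ)) × (ℕ × ℕ)))
  refine PrimrecPred.and (PrimrecPred.and (PrimrecPred.and ?_ ?_) ?_) (PrimrecPred.and
    (PrimrecPred.and ?_ ?_) (primrecPred_relsSound.and primrecPred_relsComplete))
  · exact Primrec.nat_lt.comp primrec_neutral primrec_numGens
  · exact Primrec.nat_lt.comp primrec_top primrec_numGens
  · exact primrecPred_mem (Primrec.pair (primrec_singleton primrec_neutral) (Primrec.const []))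
      primrec_relations
  · exact primrecPred_isComplTable primrec_numGens (Primrec.fst.comp hT) primrec_neutral
      primrec_top
  · exact primrecPred_isComplTable primrec_numGens (Primrec.snd.comp hT) primrec_neutral
      primrec_top

end Primrec

end GermCert

end Certificates

/-! ### Good certificates present exactly the Garside monoids. -/

section CertificateGerm

theorem IsComplTable.complementLaws {n : ℕ} {T : List (List ℕ)} {e Δ : ℕ}
    (h : IsComplTable n T e Δ) (he : e < n) :
    ComplementLaws (fun s t : Fin n => (⟨tableEntry T s t, h.2.1 s s.2 t t.2⟩ : Fin n))
      (⟨e, he⟩ : Fin n) where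
  self s := Fin.ext (h.1 s s.2).1.1
  one_left s := Fin.ext (h.1 s s.2).1.2
  one_right s := Fin.ext (h.1 s s.2).2.1
  cube s t r := Fin.ext (h.2.2 s s.2 t t.2 r r.2)

namespace GermCert

variable {c : GermCert}

theorem IsGood.monoidPresentationOk (h : c.IsGood) : MonoidPresentationOk c.1 := by
  intro x hx
  rcases h.2.2.1 x hx with rfl | ⟨s, hs, t, ht, r, hr, rfl, -⟩
  · simpa [WordBelow] using h.1.1.1
  · simp [WordBelow, hs, ht, hr]

/-- By `RelsSound` there are no relations beyond `e = 1` and those of the germ, whence the universal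
property; the letters outside `Fin c.1.1` are trivial and can be dropped from words. -/
theorem IsGood.isGermPresentation (h : c.IsGood) :
    IsGermPresentation (fun s t r : Fin c.1.1 => ([s.1, t.1], [r.1]) ∈ c.1.2)
      (⟨c.neutral, h.1.1.1⟩ : Fin c.1.1) (fun s => Raw.word c.1 [s.1]) where
  map_one := Raw.word_eq_of_isRawRel (x := ([c.neutral], [])) (Or.inl h.1.2)
  map_mul s t r hr := by
    rw [← Raw.word_append]
    exact Raw.word_eq_of_isRawRel (x := ([s.1, t.1], [r.1])) (Or.inl hr)
  surj x := by
    obtain ⟨w, rfl⟩ := Raw.word_surjective x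
    induction w with
    | nil => exact ⟨[], rfl⟩
    | cons a w ih =>
      obtain ⟨u, hu⟩ := ih
      have : Raw.word c.1 (a :: w) = Raw.word c.1 [a] * Raw.word c.1 w := by
        rw [← Raw.word_append]
        rfl
      by_cases ha : a < c.1.1
      · exact ⟨⟨a, ha⟩ :: u, by rw [this, List.map_cons, List.prod_cons, hu]⟩
      · exact ⟨u, by rw [this, Raw.word_eq_one_of_le (not_lt.1 ha), one_mul, hu]⟩
  lift N _ f h₁ h₂ := by
    obtain ⟨φ, hφ⟩ := Raw.exists_hom (p := c.1)
      (fun i => if hi : i < c.1.1 then f ⟨i, hi⟩ else 1)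
      (fun i hi => by rw [dif_neg (not_lt.2 hi)])
      (fun x hx => by
        rcases h.2.2.1 x hx with rfl | ⟨s, hs, t, ht, r, hr, rfl, -⟩
        · simp [h.1.1.1, h₁]
        · simpa [hs, ht, hr] using h₂ ⟨s, hs⟩ ⟨t, ht⟩ ⟨r, hr⟩ hx)
    exact ⟨φ, fun s => by simp [hφ]⟩

/-- `RelsSound` supplies the compatibility of each relation with both complements, `RelsComplete`
the existence clauses, and the tables the rest. -/
theorem IsGood.germLaws (h : c.IsGood) :
    GermLaws
      (fun s t : Fin c.1.1 => (⟨c.rc s t, h.2.1.1.2.1 s s.2 t t.2⟩ : Fin c.1.1))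
      (fun s t : Fin c.1.1 => (⟨c.lc s t, h.2.1.2.2.1 s s.2 t t.2⟩ : Fin c.1.1))
      (⟨c.neutral, h.1.1.1⟩ : Fin c.1.1) (⟨c.top, h.1.1.2⟩ : Fin c.1.1)
      (fun s t r : Fin c.1.1 => ([s.1, t.1], [r.1]) ∈ c.1.2) := by
  have hrel : ∀ s t r : ℕ, ([s, t], [r]) ∈ c.1.2 →
      (c.rc r s = c.neutral ∧ c.rc s r = t) ∧ (c.lc r t = c.neutral ∧ c.lc t r = s) := by
    intro s t r hr
    rcases h.2.2.1 _ hr with h' | ⟨s', -, t', -, r', -, h', h''⟩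
    · simp at h'
    · simp only [Prod.mk.injEq, List.cons.injEq, and_true] at h'
      obtain ⟨⟨rfl, rfl⟩, rfl⟩ := h'
      exact h''
  refine ⟨h.2.1.1.complementLaws h.1.1.1, h.2.1.2.complementLaws h.1.1.1,
    fun s => Fin.ext (h.2.1.1.1 s s.2).2.2, fun s => Fin.ext (h.2.1.2.1 s s.2).2.2,
    fun s t r hr => ⟨Fin.ext (hrel _ _ _ hr).1.1, Fin.ext (hrel _ _ _ hr).1.2⟩,
    fun s t r hr => ⟨Fin.ext (hrel _ _ _ hr).2.1, Fin.ext (hrel _ _ _ hr).2.2⟩,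
    fun s t => ?_, fun s t => ?_⟩
  · obtain ⟨r, hr, h'⟩ := (h.2.2.2 s s.2 t t.2).1
    exact ⟨⟨r, hr⟩, h'⟩
  · obtain ⟨r, hr, h'⟩ := (h.2.2.2 s s.2 t t.2).2
    exact ⟨⟨r, hr⟩, h'⟩

theorem IsGood.isGarsideMonoid (h : c.IsGood) {M : Type*} [Monoid M] (φ : Raw c.1 ≃* M) :
    IsGarsideMonoid M :=
  (h.isGermPresentation.comp_mulEquiv φ).isGarsideMonoid h.germLaws

end GermCert

/-- The table of a binary operation on `Fin n`. -/
def tableOf {n : ℕ} (f : Fin n → Fin n → Fin n) : List (List ℕ) :=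
  List.ofFn fun s => List.ofFn fun t => (f s t).1

theorem tableEntry_tableOf {n : ℕ} (f : Fin n → Fin n → Fin n) (s t : Fin n) :
    tableEntry (tableOf f) s t = f s t := by
  simp [tableEntry, tableOf]

theorem isComplTable_tableOf {n : ℕ} {f : Fin n → Fin n → Fin n} {e Δ : Fin n}
    (h : ComplementLaws f e) (hΔ : ∀ s, f Δ s = e) : IsComplTable n (tableOf f) e Δ := by
  refine ⟨fun s hs => ?_, fun s hs t ht => ?_, fun s hs t ht r hr => ?_⟩
  · lift s to Fin n using hs
    simp only [tableEntry_tableOf, h.self, h.one_left, h.one_right, hΔ, and_self]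
  · lift s to Fin n using hs
    lift t to Fin n using ht
    rw [tableEntry_tableOf]
    exact (f s t).2
  · lift s to Fin n using hs
    lift t to Fin n using ht
    lift r to Fin n using hr
    simp only [tableEntry_tableOf, h.cube s t r]

open Classical in
/-- The certificate of a germ. -/
noncomputable def GermCert.ofGerm {n : ℕ} (rc lc : Fin n → Fin n → Fin n) (e Δ : Fin n)
    (Rel : Fin n → Fin n → Fin n → Prop) : GermCert :=
  ((n, ([e.1], []) :: ((Finset.univ : Finset (Fin n × Fin n × Fin n)).filter
    fun x => Rel x.1 x.2.1 x.2.2).toList.map fun x => ([x.1.1, x.2.1.1], [x.2.2.1])),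
    (tableOf rc, tableOf lc), (e.1, Δ.1))

theorem GermCert.mem_ofGerm_iff {n : ℕ} {rc lc : Fin n → Fin n → Fin n} {e Δ : Fin n}
    {Rel : Fin n → Fin n → Fin n → Prop} {s t r : Fin n} :
    (([s.1, t.1], [r.1]) : List ℕ × List ℕ) ∈ (GermCert.ofGerm rc lc e Δ Rel).1.2 ↔
      Rel s t r := by
  simp [GermCert.ofGerm, Fin.val_inj]

theorem GermLaws.isGood_ofGerm {n : ℕ} {rc lc : Fin n → Fin n → Fin n} {e Δ : Fin n}
    {Rel : Fin n → Fin n → Fin n → Prop} (h : GermLaws rc lc e Δ Rel) :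
    (GermCert.ofGerm rc lc e Δ Rel).IsGood := by
  have hrc : ∀ s t : Fin n, (GermCert.ofGerm rc lc e Δ Rel).rc s t = rc s t :=
    tableEntry_tableOf rc
  have hlc : ∀ s t : Fin n, (GermCert.ofGerm rc lc e Δ Rel).lc s t = lc s t :=
    tableEntry_tableOf lc
  refine ⟨⟨⟨e.2, Δ.2⟩, List.mem_cons_self⟩, ⟨isComplTable_tableOf h.right h.right_top,
    isComplTable_tableOf h.left h.left_top⟩, fun x hx => ?_, fun s hs t ht => ?_⟩
  · rcases List.mem_cons.1 hx with rfl | hx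
    · exact Or.inl rfl
    · obtain ⟨⟨s, t, r⟩, hr, rfl⟩ := List.mem_map.1 hx
      have hr : Rel s t r := by simpa using hr
      refine Or.inr ⟨s, s.2, t, t.2, r, r.2, rfl, ?_⟩
      simp only [hrc, hlc, (h.rel_right s t r hr).1, (h.rel_right s t r hr).2,
        (h.rel_left s t r hr).1, (h.rel_left s t r hr).2, and_true]
      exact ⟨rfl, rfl⟩
  · change s < n at hs
    change t < n at ht
    lift s to Fin n using hs
    lift t to Fin n using ht
    simp only [hrc, hlc]
    obtain ⟨r, h₁, h₂⟩ := h.exists_right s t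
    obtain ⟨q, hq₁, hq₂⟩ := h.exists_left s t
    exact ⟨⟨r, r.2, GermCert.mem_ofGerm_iff.2 h₁, GermCert.mem_ofGerm_iff.2 h₂⟩,
      ⟨q, q.2, GermCert.mem_ofGerm_iff.2 hq₁, GermCert.mem_ofGerm_iff.2 hq₂⟩⟩

/-- Every Garside monoid is presented by a good certificate. -/
theorem IsGarsideMonoid.exists_cert {M : Type*} [Monoid M] (h : IsGarsideMonoid M) :
    ∃ c : GermCert, c.IsGood ∧ Nonempty (Raw c.1 ≃* M) := by
  obtain ⟨n, ι, rc, lc, e, Δ, hg, hp⟩ := h.exists_germ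
  have hgood := hg.isGood_ofGerm
  generalize hc : GermCert.ofGerm rc lc e Δ (fun s t r => ι s * ι t = ι r) = c at hgood
  refine ⟨c, hgood, ?_⟩
  have hn : c.1.1 = n := by rw [← hc]; rfl
  -- The certificate has the generators and relations of the germ, so the two universal properties
  -- give mutually inverse homomorphisms.
  obtain ⟨ψ, hψ⟩ := hp.lift (Raw c.1) (fun s => Raw.word c.1 [s.1])
    (Raw.word_eq_of_isRawRel (x := ([e.1], [])) (Or.inl (by rw [← hc]; exact List.mem_cons_self)))
    (fun s t r hr => by
      rw [← Raw.word_append]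
      exact Raw.word_eq_of_isRawRel (x := ([s.1, t.1], [r.1]))
        (Or.inl (by rw [← hc]; exact GermCert.mem_ofGerm_iff.2 hr)))
  obtain ⟨φ, hφ⟩ := Raw.exists_hom (p := c.1) (fun i => if hi : i < n then ι ⟨i, hi⟩ else 1)
    (fun i hi => by rw [dif_neg (by omega)])
    (fun x hx => by
      rw [← hc] at hx
      rcases List.mem_cons.1 hx with rfl | hx
      · simp [hp.map_one]
      · obtain ⟨⟨s, t, r⟩, hr, rfl⟩ := List.mem_map.1 hx
        simpa using hr)
  refine ⟨MonoidHom.toMulEquiv φ ψ (Raw.hom_ext fun i hi => ?_) (MonoidHom.ext fun x => ?_)⟩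
  · rw [hn] at hi
    simp [hφ, hi, hψ]
  · obtain ⟨u, rfl⟩ := hp.surj x
    induction u with
    | nil => simp
    | cons s u ih =>
      rw [List.map_cons, List.prod_cons, map_mul, ih]
      simp [hψ, hφ]

end CertificateGerm

/-! ### Ore embedding and groups of fractions of Gaussian monoids. -/

section Fractions

variable {M : Type*} [Monoid M]

theorem IsGaussianMonoid.exists_left_common_multiple (h : IsGaussianMonoid M) (x y : M) :
    ∃ a b, a * x = b * y := by
  obtain ⟨z, ⟨a, ha⟩, ⟨b, hb⟩, -⟩ := h.left_lcm x y
  exact ⟨a, b, ha.symm.trans hb⟩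

theorem IsGaussianMonoid.exists_right_common_multiple (h : IsGaussianMonoid M) (x y : M) :
    ∃ a b, x * a = y * b := by
  obtain ⟨z, ⟨a, ha⟩, ⟨b, hb⟩, -⟩ := h.right_lcm x y
  exact ⟨a, b, ha.symm.trans hb⟩

/-- A Gaussian monoid embeds in the group of units of its Ore localization. -/
theorem IsGaussianMonoid.exists_injective_hom {M : Type u} [Monoid M] (h : IsGaussianMonoid M) :
    ∃ (H : Type u) (_ : Group H) (f : M →* H), Function.Injective f := by
  have := h.cancel
  choose a b hab using h.exists_left_common_multiple
  -- Common left multiples are the Ore condition; right cancellation lets `1` serve as the witness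
  -- of the other axiom.
  let _ : OreLocalization.OreSet (⊤ : Submonoid M) :=
    { ore_right_cancel := fun r₁ r₂ s hs => ⟨1, by rw [mul_right_cancel hs]⟩
      oreNum := fun r s => b r s
      oreDenom := fun r s => ⟨a r s, trivial⟩
      ore_eq := fun r s => hab r s }
  let f : M →* (OreLocalization (⊤ : Submonoid M) M)ˣ :=
    IsUnit.liftRight OreLocalization.numeratorHom fun x =>
      OreLocalization.numerator_isUnit (⟨x, trivial⟩ : (⊤ : Submonoid M))
  refine ⟨_, inferInstance, f, fun x y hxy => ?_⟩
  have h₁ : (OreLocalization.numeratorHom x : OreLocalization (⊤ : Submonoid M) M) =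
      OreLocalization.numeratorHom y := congrArg Units.val hxy
  rw [OreLocalization.numeratorHom_apply, OreLocalization.numeratorHom_apply,
    OreLocalization.oreDiv_eq_iff] at h₁
  obtain ⟨u, v, h₂, h₃⟩ := h₁
  -- Equality of two numerators means equality after multiplication on the left by a common factor,
  -- which cancels.
  have h₄ : (u : M) = v := by simpa using h₃
  have h₅ : (u : M) * y = v * x := h₂
  rw [h₄] at h₅
  exact (mul_left_cancel h₅).symm

variable {G : Type*} [Group G] {j : M →* G}

/-- Left fractions are stable under left multiplication by `(j m)⁻¹`, which joins the denominator,
and by `j m`: if `a * m = b * x`, then `j m * (j x)⁻¹ = (j a)⁻¹ * j b`. -/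
theorem IsGaussianMonoid.exists_left_fraction (h : IsGaussianMonoid M)
    (hj : Subgroup.closure (Set.range j) = ⊤) (g : G) : ∃ x y : M, g = (j x)⁻¹ * j y := by
  have hg : g ∈ Subgroup.closure (Set.range j) := by rw [hj]; trivial
  induction hg using Subgroup.closure_induction_left with
  | one => exact ⟨1, 1, by simp⟩
  | mul_left m hm g hg ih =>
    obtain ⟨m, rfl⟩ := hm
    obtain ⟨x, y, rfl⟩ := ih
    obtain ⟨a, b, hab⟩ := h.exists_left_common_multiple m x
    refine ⟨a, b * y, ?_⟩
    have hab' : j a * j m = j b * j x := by rw [← map_mul, hab, map_mul]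
    rw [eq_inv_mul_iff_mul_eq, ← mul_assoc, hab', map_mul]
    group
  | inv_mul_cancel m hm g hg ih =>
    obtain ⟨m, rfl⟩ := hm
    obtain ⟨x, y, rfl⟩ := ih
    exact ⟨x * m, y, by rw [map_mul, mul_inv_rev, mul_assoc]⟩

theorem IsGaussianMonoid.exists_right_fraction (h : IsGaussianMonoid M)
    (hj : Subgroup.closure (Set.range j) = ⊤) (g : G) : ∃ x y : M, g = j x * (j y)⁻¹ := by
  have hg : g ∈ Subgroup.closure (Set.range j) := by rw [hj]; trivial
  induction hg using Subgroup.closure_induction_left with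
  | one => exact ⟨1, 1, by simp⟩
  | mul_left m hm g hg ih =>
    obtain ⟨m, rfl⟩ := hm
    obtain ⟨x, y, rfl⟩ := ih
    exact ⟨m * x, y, by rw [map_mul, mul_assoc]⟩
  | inv_mul_cancel m hm g hg ih =>
    obtain ⟨m, rfl⟩ := hm
    obtain ⟨x, y, rfl⟩ := ih
    obtain ⟨a, b, hab⟩ := h.exists_right_common_multiple m x
    refine ⟨a, y * b, ?_⟩
    have hab' : j m * j a = j x * j b := by rw [← map_mul, hab, map_mul]
    rw [inv_mul_eq_iff_eq_mul, ← mul_assoc, hab', map_mul]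
    group

theorem IsGaussianMonoid.isGroupOfFractions (h : IsGaussianMonoid M)
    (hj : Subgroup.closure (Set.range j) = ⊤) (hinj : Function.Injective j) :
    IsGroupOfFractions j :=
  ⟨hinj, h.exists_left_fraction hj, h.exists_right_fraction hj⟩

/-- A group generated by the image of a Gaussian monoid and that maps compatibly to a group of
fractions of the monoid is isomorphic to it. -/
theorem IsGroupOfFractions.bijective_of_comp_eq {G' : Type*} [Group G'] (h : IsGaussianMonoid M)
    (hj : Subgroup.closure (Set.range j) = ⊤) {ι : M →* G'} (hι : IsGroupOfFractions ι)
    (F : G →* G') (hF : ∀ x, F (j x) = ι x) : Function.Bijective F := by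
  constructor
  · rw [injective_iff_map_eq_one]
    intro g hg
    obtain ⟨x, y, rfl⟩ := h.exists_left_fraction hj g
    rw [map_mul, map_inv, hF, hF, inv_mul_eq_one] at hg
    rw [hι.injective hg, inv_mul_cancel]
  · intro g
    obtain ⟨x, y, rfl⟩ := hι.left_fraction g
    exact ⟨(j x)⁻¹ * j y, by rw [map_mul, map_inv, hF, hF]⟩

theorem IsGroupOfFractions.comp_mulEquiv {M' G' : Type*} [Monoid M'] [Group G'] {ι : M →* G}
    (h : IsGroupOfFractions ι) (φ : M' ≃* M) (ψ : G ≃* G') :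
    IsGroupOfFractions (ψ.toMonoidHom.comp (ι.comp φ.toMonoidHom)) where
  injective := ψ.injective.comp (h.injective.comp φ.injective)
  left_fraction g := by
    obtain ⟨x, y, hxy⟩ := h.left_fraction (ψ.symm g)
    exact ⟨φ.symm x, φ.symm y, by simpa [MulEquiv.symm_apply_eq] using hxy⟩
  right_fraction g := by
    obtain ⟨x, y, hxy⟩ := h.right_fraction (ψ.symm g)
    exact ⟨φ.symm x, φ.symm y, by simpa [MulEquiv.symm_apply_eq] using hxy⟩

end Fractions

/-! ### Reduction to the alphabet `ℕ`, and enveloping groups. -/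

section Presentations

theorem exists_map_val_eq {n : ℕ} {w : List ℕ} (hw : WordBelow n w) :
    ∃ u : List (Fin n), u.map Fin.val = w :=
  ⟨w.pmap Fin.mk fun a ha => hw a ha, by simp [List.map_pmap]⟩

theorem exists_signed_map_val_eq {n : ℕ} {w : List (ℕ × Bool)} (hw : SignedWordBelow n w) :
    ∃ u : List (Fin n × Bool), u.map (Prod.map Fin.val id) = w :=
  ⟨w.pmap (fun a (ha : a.1 < n) => (⟨a.1, ha⟩, a.2)) fun a ha => hw a ha, by
    simp [List.map_pmap]⟩

theorem MonoidPresentation.nonempty_mulEquiv_raw (P : MonoidPresentation) :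
    Nonempty (P.toMonoid ≃* Raw P.1) := by
  have hlift : ∀ w : FreeMonoid (Fin P.1.1), FreeMonoid.lift (fun i : Fin P.1.1 =>
      Raw.word P.1 [i.1]) w = Raw.word P.1 (w.toList.map Fin.val) := fun w => by
    rw [FreeMonoid.lift_apply, Raw.word_eq_prod, List.map_map]
    rfl
  obtain ⟨ψ, hψ⟩ := Raw.exists_hom (p := P.1) (N := P.toMonoid)
    (fun i => if hi : i < P.1.1 then PresentedMonoid.of _ ⟨i, hi⟩ else 1)
    (fun i hi => by rw [dif_neg (not_lt.2 hi)])
    (fun x hx => by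
      obtain ⟨h₁, h₂⟩ := P.2 x hx
      obtain ⟨u, hu⟩ := exists_map_val_eq h₁
      obtain ⟨v, hv⟩ := exists_map_val_eq h₂
      have key : ∀ w : List (Fin P.1.1), ((w.map Fin.val).map fun i =>
          if hi : i < P.1.1 then PresentedMonoid.of P.rels ⟨i, hi⟩ else 1).prod =
          PresentedMonoid.mk P.rels (FreeMonoid.ofList w) := fun w => by
        induction w with
        | nil => rfl
        | cons a w ih =>
          rw [List.map_cons, List.map_cons, List.prod_cons, ih, FreeMonoid.ofList_cons, map_mul]
          simp [PresentedMonoid.of]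
      rw [← hu, ← hv, key, key]
      refine PresentedMonoid.mk_eq_mk_of_rel ?_
      change (u.map Fin.val, v.map Fin.val) ∈ P.1.2
      rwa [hu, hv])
  let φ : P.toMonoid →* Raw P.1 := PresentedMonoid.lift (fun i => Raw.word P.1 [i.1])
    (fun u v huv => by
      rw [hlift, hlift]
      exact Raw.word_eq_of_isRawRel (Or.inl huv))
  have hφ : ∀ i, φ (PresentedMonoid.of _ i) = Raw.word P.1 [i.1] := fun i => rfl
  refine ⟨MonoidHom.toMulEquiv φ ψ (PresentedMonoid.ext _ fun i => ?_)
    (Raw.hom_ext fun i hi => ?_)⟩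
  · simp [hφ, hψ]
  · simp [hφ, hψ, hi]

/-- The monoid word of a signed word: the letter `i` becomes `2 * i` and its inverse
`2 * i + 1`. -/
def unsignWord (w : List (ℕ × Bool)) : List ℕ := w.map fun a => 2 * a.1 + cond a.2 0 1

/-- The monoid presentation, on twice as many letters, of the group with a given group
presentation. -/
def unsign (p : ℕ × List (List (ℕ × Bool) × List (ℕ × Bool))) : RawPresentation :=
  (2 * p.1, p.2.map (fun x => (unsignWord x.1, unsignWord x.2)) ++
    ((List.range p.1).map (fun i => ([2 * i, 2 * i + 1], [])) ++
      (List.range p.1).map (fun i => ([2 * i + 1, 2 * i], []))))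

/-- With letters for the inverses and the relations `x x⁻¹ = x⁻¹ x = 1`, a group presentation
becomes a monoid presentation of the same group; the results on isomorphism of monoids then cover
groups. -/
theorem GroupPresentation.nonempty_mulEquiv_raw (P : GroupPresentation) :
    Nonempty (P.toGroup ≃* Raw (unsign P.1)) := by
  have h₁ : ∀ i : Fin P.1.1, Raw.word (unsign P.1) [2 * i.1] *
      Raw.word (unsign P.1) [2 * i.1 + 1] = 1 := fun i => by
    rw [← Raw.word_append]
    refine Raw.word_eq_of_isRawRel (x := ([2 * i.1, 2 * i.1 + 1], [])) (Or.inl ?_)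
    simp only [unsign, List.mem_append, List.mem_map, List.mem_range]
    exact Or.inr (Or.inl ⟨i, i.2, rfl⟩)
  have h₂ : ∀ i : Fin P.1.1, Raw.word (unsign P.1) [2 * i.1 + 1] *
      Raw.word (unsign P.1) [2 * i.1] = 1 := fun i => by
    rw [← Raw.word_append]
    refine Raw.word_eq_of_isRawRel (x := ([2 * i.1 + 1, 2 * i.1], [])) (Or.inl ?_)
    simp only [unsign, List.mem_append, List.mem_map, List.mem_range]
    exact Or.inr (Or.inr ⟨i, i.2, rfl⟩)
  -- `Raw` carries only a monoid structure, so the homomorphism from the group is built into its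
  -- units.
  let g : Fin P.1.1 → (Raw (unsign P.1))ˣ := fun i => ⟨_, _, h₁ i, h₂ i⟩
  have hg : ∀ u : List (Fin P.1.1 × Bool), (FreeGroup.lift g (FreeGroup.mk u)).val =
      Raw.word (unsign P.1) (unsignWord (u.map (Prod.map Fin.val id))) := fun u => by
    rw [FreeGroup.lift_mk]
    induction u with
    | nil => rfl
    | cons a u ih =>
      have : unsignWord ((a :: u).map (Prod.map Fin.val id)) =
          [2 * a.1.1 + cond a.2 0 1] ++ unsignWord (u.map (Prod.map Fin.val id)) := rfl
      rw [this, Raw.word_append, ← ih, List.map_cons, List.prod_cons, Units.val_mul]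
      rcases a with ⟨i, _ | _⟩ <;> rfl
  have hrels : ∀ r ∈ P.rels, FreeGroup.lift g r = 1 := by
    rintro _ ⟨u, v, huv, rfl⟩
    rw [map_mul, map_inv, mul_inv_eq_one]
    refine Units.ext ?_
    rw [hg, hg]
    refine Raw.word_eq_of_isRawRel (x := (_, _)) (Or.inl ?_)
    exact List.mem_append_left _ (List.mem_map.2 ⟨_, huv, rfl⟩)
  let φ₀ : P.toGroup →* (Raw (unsign P.1))ˣ := PresentedGroup.toGroup hrels
  let φ : P.toGroup →* Raw (unsign P.1) := (Units.coeHom _).comp φ₀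
  have hφ : ∀ i : Fin P.1.1, φ (PresentedGroup.of i) = Raw.word (unsign P.1) [2 * i.1] := fun i =>
    congrArg Units.val (PresentedGroup.toGroup.of hrels)
  have hφ_inv : ∀ i : Fin P.1.1, φ (PresentedGroup.of i)⁻¹ = Raw.word (unsign P.1) [2 * i.1 + 1] :=
    fun i => by
      change (φ₀ (PresentedGroup.of i)⁻¹).val = _
      rw [map_inv, PresentedGroup.toGroup.of]
      rfl
  -- This decodes `unsignWord`: even letters are generators, odd ones inverses, and letters from `2
  -- * P.1.1` on are trivial.
  let f : ℕ → P.toGroup := fun k => if hk : k / 2 < P.1.1 then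
    (if k % 2 = 0 then PresentedGroup.of ⟨k / 2, hk⟩ else (PresentedGroup.of ⟨k / 2, hk⟩)⁻¹) else 1
  have hf : ∀ i : Fin P.1.1, f (2 * i.1) = PresentedGroup.of i := fun i => by
    simp [f]
  have hf_inv : ∀ i : Fin P.1.1, f (2 * i.1 + 1) = (PresentedGroup.of i)⁻¹ := fun i => by
    have : (2 * i.1 + 1) / 2 = i.1 := by omega
    simp [f, this]
  have hfw : ∀ u : List (Fin P.1.1 × Bool),
      ((unsignWord (u.map (Prod.map Fin.val id))).map f).prod =
        PresentedGroup.mk P.rels (FreeGroup.mk u) := fun u => by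
    induction u with
    | nil => rfl
    | cons a u ih =>
      have h₃ : unsignWord ((a :: u).map (Prod.map Fin.val id)) =
          (2 * a.1.1 + cond a.2 0 1) :: unsignWord (u.map (Prod.map Fin.val id)) := rfl
      have h₄ : (FreeGroup.mk (a :: u) : FreeGroup (Fin P.1.1)) =
          FreeGroup.mk [a] * FreeGroup.mk u := by
        rw [FreeGroup.mul_mk]
        rfl
      rw [h₃, h₄, List.map_cons, List.prod_cons, ih, map_mul]
      congr 1
      rcases a with ⟨i, _ | _⟩
      · exact hf_inv i
      · exact hf i
  obtain ⟨ψ, hψ⟩ := Raw.exists_hom (p := unsign P.1) f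
    (fun i hi => by
      have : ¬ i / 2 < P.1.1 := by
        change 2 * P.1.1 ≤ i at hi
        omega
      simp only [f, dif_neg this])
    (fun x hx => by
      simp only [unsign, List.mem_append, List.mem_map, List.mem_range] at hx
      rcases hx with ⟨y, hy, rfl⟩ | ⟨i, hi, rfl⟩ | ⟨i, hi, rfl⟩
      · obtain ⟨hy₁, hy₂⟩ := P.2 y hy
        obtain ⟨u, hu⟩ := exists_signed_map_val_eq hy₁
        obtain ⟨v, hv⟩ := exists_signed_map_val_eq hy₂
        dsimp only
        rw [← hu, ← hv, hfw, hfw]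
        exact PresentedGroup.mk_eq_mk_of_mul_inv_mem ⟨u, v, by rwa [hu, hv], rfl⟩
      · simpa [hf ⟨i, hi⟩] using congrArg (PresentedGroup.of ⟨i, hi⟩ * ·) (hf_inv ⟨i, hi⟩)
      · simpa [hf ⟨i, hi⟩] using congrArg (· * PresentedGroup.of ⟨i, hi⟩) (hf_inv ⟨i, hi⟩))
  refine ⟨MonoidHom.toMulEquiv φ ψ (PresentedGroup.ext fun i => ?_) (Raw.hom_ext fun i hi => ?_)⟩
  · simp [hφ, hψ, hf]
  · change i < 2 * P.1.1 at hi
    obtain ⟨k, hk⟩ : ∃ k : Fin P.1.1, i = 2 * k.1 ∨ i = 2 * k.1 + 1 :=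
      ⟨⟨i / 2, by omega⟩, by dsimp only; omega⟩
    rw [MonoidHom.comp_apply, hψ, MonoidHom.id_apply, List.map_singleton, List.prod_singleton]
    rcases hk with rfl | rfl
    · rw [hf, hφ]
    · rw [hf_inv, hφ_inv]

/-- The group presentation with the generators and relations of a monoid presentation. -/
def signed (p : RawPresentation) : ℕ × List (List (ℕ × Bool) × List (ℕ × Bool)) :=
  (p.1, p.2.map fun x => (x.1.map fun a => (a, true), x.2.map fun a => (a, true)))

theorem groupPresentationOk_signed {p : RawPresentation} (h : MonoidPresentationOk p) :
    GroupPresentationOk (signed p) := by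
  intro x hx
  obtain ⟨y, hy, rfl⟩ := List.mem_map.1 hx
  obtain ⟨h₁, h₂⟩ := h y hy
  constructor
  · intro a ha
    obtain ⟨b, hb, rfl⟩ := List.mem_map.1 ha
    exact h₁ b hb
  · intro a ha
    obtain ⟨b, hb, rfl⟩ := List.mem_map.1 ha
    exact h₂ b hb

/-- The presentation of the enveloping group of a presented monoid. -/
def MonoidPresentation.groupPresentation (Q : MonoidPresentation) : GroupPresentation :=
  ⟨signed Q.1, groupPresentationOk_signed Q.2⟩

theorem list_prod_map_eq_lift {α H : Type*} [Group H] (f : α → H) (u : List α) :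
    (u.map f).prod = FreeGroup.lift f (FreeGroup.mk (u.map fun a => (a, true))) := by
  rw [FreeGroup.lift_mk, List.map_map]
  rfl

theorem list_prod_map_of {α : Type*} (rels : Set (FreeGroup α)) (u : List α) :
    (u.map (PresentedGroup.of (rels := rels))).prod =
      PresentedGroup.mk rels (FreeGroup.mk (u.map fun a => (a, true))) := by
  rw [list_prod_map_eq_lift]
  exact (FreeGroup.lift_unique (PresentedGroup.mk rels) fun i => rfl).symm

theorem map_val_map_true {n : ℕ} (u : List (Fin n)) :
    (u.map Fin.val).map (fun a => (a, true)) =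
      (u.map fun a => (a, true)).map (Prod.map Fin.val id) := by
  simp [Function.comp_def]

theorem lift_mul_inv_eq_one {α H : Type*} [Group H] {f : α → H} {a b : FreeGroup α}
    (h : FreeGroup.lift f a = FreeGroup.lift f b) : FreeGroup.lift f (a * b⁻¹) = 1 := by
  rw [map_mul, map_inv, h, mul_inv_cancel]

namespace MonoidPresentation

variable (Q : MonoidPresentation)

theorem mem_groupPresentation_rels {u v : FreeMonoid (Fin Q.1.1)} (h : Q.rels u v) :
    (FreeGroup.mk (u.toList.map fun a => (a, true)) *
      (FreeGroup.mk (v.toList.map fun a => (a, true)))⁻¹ : FreeGroup (Fin Q.1.1)) ∈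
      Q.groupPresentation.rels :=
  ⟨_, _, List.mem_map.2 ⟨_, h, Prod.ext (map_val_map_true _) (map_val_map_true _)⟩, rfl⟩

/-- The canonical homomorphism from a presented monoid to its enveloping group. -/
def toEnvelope : Q.toMonoid →* Q.groupPresentation.toGroup :=
  PresentedMonoid.lift (fun i => (PresentedGroup.of i : Q.groupPresentation.toGroup))
    (fun u v huv => by
      refine (FreeMonoid.lift_apply _ _).trans (Eq.trans ?_ (FreeMonoid.lift_apply _ _).symm)
      exact (list_prod_map_of _ _).trans ((PresentedGroup.mk_eq_mk_of_mul_inv_mem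
        (Q.mem_groupPresentation_rels huv)).trans (list_prod_map_of _ _).symm))

theorem closure_range_toEnvelope : Subgroup.closure (Set.range Q.toEnvelope) = ⊤ := by
  rw [eq_top_iff, ← PresentedGroup.closure_range_of, Subgroup.closure_le]
  rintro _ ⟨i, rfl⟩
  exact Subgroup.subset_closure ⟨PresentedMonoid.of _ i, rfl⟩

/-- The universal property of the enveloping group: its relators are quotients of positive words
related in `Q`, which `f` identifies. -/
theorem exists_hom_envelope {H : Type*} [Group H] (f : Q.toMonoid →* H) :
    ∃ F : Q.groupPresentation.toGroup →* H, ∀ x, F (Q.toEnvelope x) = f x := by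
  have hf : ∀ u : List (Fin Q.1.1), FreeGroup.lift (fun i => f (PresentedMonoid.of _ i))
      (FreeGroup.mk (u.map fun a => (a, true))) = f (PresentedMonoid.mk _ (FreeMonoid.ofList u)) :=
    fun u => by
      rw [← list_prod_map_eq_lift]
      induction u with
      | nil => simp
      | cons a u ih =>
        rw [List.map_cons, List.prod_cons, ih, FreeMonoid.ofList_cons, map_mul, map_mul]
        rfl
  have hrels : ∀ r ∈ Q.groupPresentation.rels,
      FreeGroup.lift (fun i : Fin Q.1.1 => f (PresentedMonoid.of _ i)) r = 1 := by
    rintro _ ⟨u, v, huv, rfl⟩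
    obtain ⟨x, hx, hxuv⟩ := List.mem_map.1 huv
    -- A relator is given by signed words; those that come from a relation of `Q` have only positive
    -- letters.
    have hsplit : ∀ (w : List (Fin Q.1.1 × Bool)) (z : List ℕ),
        z.map (fun a => (a, true)) = w.map (Prod.map Fin.val id) →
        ∃ w' : List (Fin Q.1.1), w = w'.map (fun a => (a, true)) ∧ w'.map Fin.val = z := by
      intro w z hzw
      refine ⟨w.map Prod.fst, ?_, ?_⟩
      · rw [List.map_map]
        refine (List.map_id w).symm.trans (List.map_congr_left fun a ha => ?_)
        have : (Prod.map Fin.val id a) ∈ z.map (fun a => (a, true)) := by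
          rw [hzw]
          exact List.mem_map_of_mem ha
        obtain ⟨b, -, hb⟩ := List.mem_map.1 this
        exact Prod.ext rfl (congrArg Prod.snd hb).symm
      · have := congrArg (List.map Prod.fst) hzw
        simpa [List.map_map, Function.comp_def] using this.symm
    obtain ⟨h₁, h₂⟩ := Prod.mk.inj hxuv
    obtain ⟨u', rfl, hu'⟩ := hsplit u _ h₁
    obtain ⟨v', rfl, hv'⟩ := hsplit v _ h₂
    refine lift_mul_inv_eq_one ((hf u').trans (Eq.trans ?_ (hf v').symm))
    rw [PresentedMonoid.mk_eq_mk_of_rel (show Q.rels (FreeMonoid.ofList u') (FreeMonoid.ofList v')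
      from ?_)]
    change (u'.map Fin.val, v'.map Fin.val) ∈ Q.1.2
    rwa [hu', hv']
  let F : Q.groupPresentation.toGroup →* H := PresentedGroup.toGroup hrels
  refine ⟨F, fun x => ?_⟩
  have : F.comp Q.toEnvelope = f := PresentedMonoid.ext _ fun i => PresentedGroup.toGroup.of hrels
  exact DFunLike.congr_fun this x

/-- For injectivity it is enough that the monoid embeds in some group: that embedding factors
through the envelope. -/
theorem isGroupOfFractions_toEnvelope (h : IsGarsideMonoid Q.toMonoid) :
    IsGroupOfFractions Q.toEnvelope := by
  refine h.gaussian.isGroupOfFractions Q.closure_range_toEnvelope ?_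
  obtain ⟨H, _, f, hf⟩ := h.gaussian.exists_injective_hom
  obtain ⟨F, hF⟩ := Q.exists_hom_envelope f
  refine Function.Injective.of_comp (f := F) ?_
  have : F ∘ Q.toEnvelope = f := funext hF
  rwa [this]

theorem nonempty_mulEquiv_of_isGroupOfFractions (h : IsGarsideMonoid Q.toMonoid)
    {M : Type*} [Monoid M] (φ : Q.toMonoid ≃* M) {G : Type*} [Group G] {ι : M →* G}
    (hι : IsGroupOfFractions ι) : Nonempty (Q.groupPresentation.toGroup ≃* G) := by
  have hι' := hι.comp_mulEquiv φ (MulEquiv.refl G)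
  obtain ⟨F, hF⟩ := Q.exists_hom_envelope ((MulEquiv.refl G).toMonoidHom.comp (ι.comp φ.toMonoidHom))
  exact ⟨MulEquiv.ofBijective F
    (IsGroupOfFractions.bijective_of_comp_eq h.gaussian Q.closure_range_toEnvelope hι' F hF)⟩

theorem isGarsideGroup_of_mulEquiv (h : IsGarsideMonoid Q.toMonoid) {G : Type} [Group G]
    (φ : Q.groupPresentation.toGroup ≃* G) : IsGarsideGroup G :=
  ⟨Q.toMonoid, inferInstance, _, h,
    (Q.isGroupOfFractions_toEnvelope h).comp_mulEquiv (MulEquiv.refl _) φ⟩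

end MonoidPresentation

end Presentations

/-! ### Existential descriptions of Garside monoids and groups. -/

section Main

theorem primrec_unsign : Primrec unsign := by
  have hw : Primrec unsignWord := by
    refine Primrec.list_map Primrec.id ?_
    exact Primrec.nat_add.comp (Primrec.nat_double.comp (Primrec.fst.comp Primrec.snd))
      ((Primrec.dom_bool fun b => cond b 0 1).comp (Primrec.snd.comp Primrec.snd))
  have hr : Primrec fun p : ℕ × List (List (ℕ × Bool) × List (ℕ × Bool)) => List.range p.1 :=
    Primrec.list_range.comp Primrec.fst
  have he : Primrec fun x : (ℕ × List (List (ℕ × Bool) × List (ℕ × Bool))) × ℕ => 2 * x.2 :=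
    Primrec.nat_double.comp Primrec.snd
  have ho : Primrec fun x : (ℕ × List (List (ℕ × Bool) × List (ℕ × Bool))) × ℕ => 2 * x.2 + 1 :=
    Primrec.nat_double_succ.comp Primrec.snd
  refine Primrec.pair (Primrec.nat_double.comp Primrec.fst) (Primrec.list_append.comp ?_
    (Primrec.list_append.comp ?_ ?_))
  · exact Primrec.list_map Primrec.snd (Primrec.pair (hw.comp (Primrec.fst.comp Primrec.snd))
      (hw.comp (Primrec.snd.comp Primrec.snd)))
  · exact Primrec.list_map hr (Primrec.pair (Primrec.list_cons.comp he
      (Primrec.list_cons.comp ho (Primrec.const []))) (Primrec.const []))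
  · exact Primrec.list_map hr (Primrec.pair (Primrec.list_cons.comp ho
      (Primrec.list_cons.comp he (Primrec.const []))) (Primrec.const []))

theorem primrec_signed : Primrec signed := by
  have hw : Primrec fun w : List ℕ => w.map fun a => (a, true) :=
    Primrec.list_map Primrec.id (Primrec.pair Primrec.snd (Primrec.const true))
  exact Primrec.pair Primrec.fst (Primrec.list_map Primrec.snd (Primrec.pair
    (hw.comp (Primrec.fst.comp Primrec.snd)) (hw.comp (Primrec.snd.comp Primrec.snd))))

/-- The monoid presentation of a good certificate. -/
def GermCert.IsGood.presentation {c : GermCert} (h : c.IsGood) : MonoidPresentation :=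
  ⟨c.1, h.monoidPresentationOk⟩

theorem GermCert.IsGood.isGarsideMonoid_presentation {c : GermCert} (h : c.IsGood) :
    IsGarsideMonoid h.presentation.toMonoid := by
  obtain ⟨φ⟩ := h.presentation.nonempty_mulEquiv_raw
  exact h.isGarsideMonoid φ.symm

/-- The right-hand side is an existential quantifier over certificates in front of a decidable
condition and a semidecidable one. -/
theorem isGarsideMonoid_toMonoid_iff (P : MonoidPresentation) :
    IsGarsideMonoid P.toMonoid ↔ ∃ c : GermCert, c.IsGood ∧ Nonempty (Raw P.1 ≃* Raw c.1) := by
  obtain ⟨φ⟩ := P.nonempty_mulEquiv_raw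
  constructor
  · intro h
    obtain ⟨c, hc, ⟨ψ⟩⟩ := h.exists_cert
    exact ⟨c, hc, ⟨(ψ.trans φ).symm⟩⟩
  · rintro ⟨c, hc, ⟨ψ⟩⟩
    exact hc.isGarsideMonoid (ψ.symm.trans φ.symm)

/-- Every Garside group has a presentation given by a good certificate. -/
theorem IsGarsideGroup.exists_cert {G : Type u} [Group G] (h : IsGarsideGroup G) :
    ∃ (c : GermCert) (hc : c.IsGood),
      Nonempty (hc.presentation.groupPresentation.toGroup ≃* G) := by
  obtain ⟨M, _, ι, hM, hι⟩ := h
  obtain ⟨c, hc, ⟨ψ⟩⟩ := hM.exists_cert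
  obtain ⟨φ⟩ := hc.presentation.nonempty_mulEquiv_raw
  exact ⟨c, hc, hc.presentation.nonempty_mulEquiv_of_isGroupOfFractions
    hc.isGarsideMonoid_presentation (φ.trans ψ) hι⟩

/-- `signed` passes to the enveloping group of the certified monoid, and `unsign` back to monoid
presentations, to which `Raw.sigmaOne_mulEquiv` applies. -/
theorem isGarsideGroup_toGroup_iff (P : GroupPresentation) :
    IsGarsideGroup P.toGroup ↔ ∃ c : GermCert, c.IsGood ∧
      Nonempty (Raw (unsign P.1) ≃* Raw (unsign (signed c.1))) := by
  obtain ⟨φ⟩ := P.nonempty_mulEquiv_raw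
  constructor
  · intro h
    obtain ⟨c, hc, ⟨ψ⟩⟩ := h.exists_cert
    obtain ⟨θ⟩ := hc.presentation.groupPresentation.nonempty_mulEquiv_raw
    exact ⟨c, hc, ⟨(φ.symm.trans ψ.symm).trans θ⟩⟩
  · rintro ⟨c, hc, ⟨ψ⟩⟩
    obtain ⟨θ⟩ := hc.presentation.groupPresentation.nonempty_mulEquiv_raw
    exact hc.presentation.isGarsideGroup_of_mulEquiv hc.isGarsideMonoid_presentation
      ((θ.trans ψ.symm).trans φ.symm)

theorem primrec_val_monoidPresentation : Primrec fun P : MonoidPresentation => P.1 :=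
  @Primrec.subtype_val _ _ _ _ primrecPred_monoidPresentationOk

theorem primrec_val_groupPresentation : Primrec fun P : GroupPresentation => P.1 :=
  @Primrec.subtype_val _ _ _ _ primrecPred_groupPresentationOk

theorem sigmaOne_isGarsideMonoid :
    SigmaOne fun P : MonoidPresentation => IsGarsideMonoid P.toMonoid := by
  have hP : Primrec fun x : MonoidPresentation × GermCert => x.1.1 :=
    primrec_val_monoidPresentation.comp Primrec.fst
  have h := ((SigmaOne.of_primrecPred GermCert.primrecPred_isGood).comp
    (Primrec.snd (α := MonoidPresentation))).and (Raw.sigmaOne_mulEquiv.comp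
      (Primrec.pair hP (Primrec.fst.comp Primrec.snd)))
  exact h.exists_of_prod.of_eq fun P => (isGarsideMonoid_toMonoid_iff P).symm

theorem sigmaOne_isGarsideGroup :
    SigmaOne fun P : GroupPresentation => IsGarsideGroup P.toGroup := by
  have hP : Primrec fun x : GroupPresentation × GermCert => x.1.1 :=
    primrec_val_groupPresentation.comp Primrec.fst
  have h := ((SigmaOne.of_primrecPred GermCert.primrecPred_isGood).comp
    (Primrec.snd (α := GroupPresentation))).and (Raw.sigmaOne_mulEquiv.comp
      (Primrec.pair (primrec_unsign.comp hP)
        (primrec_unsign.comp (primrec_signed.comp (Primrec.fst.comp Primrec.snd)))))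
  exact h.exists_of_prod.of_eq fun P => (isGarsideGroup_toGroup_iff P).symm

theorem isGarsideMonoid_of_subsingleton (M : Type*) [Monoid M] [Subsingleton M] :
    IsGarsideMonoid M := by
  have hd : ∀ x y : M, x ∣ y := fun x y => ⟨1, Subsingleton.elim _ _⟩
  have hr : ∀ x y : M, x ∣ᵣ y := fun x y => ⟨1, Subsingleton.elim _ _⟩
  refine ⟨⟨⟨Subsingleton.elim _ _, fun x => ⟨0, fun l hl _ => ?_⟩⟩, ?_,
    fun x y => ⟨1, hd _ _, hd _ _, fun _ _ _ => hd _ _⟩,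
    fun x y => ⟨1, hr _ _, hr _ _, fun _ _ _ => hr _ _⟩,
    fun x y => ⟨1, hr _ _, hr _ _, fun _ _ _ => hr _ _⟩,
    fun x y => ⟨1, hd _ _, hd _ _, fun _ _ _ => hd _ _⟩⟩,
    1, fun x => ⟨fun _ => hr _ _, fun _ => hd _ _⟩, Set.toFinite _, Subsingleton.elim _ _⟩
  · rcases l with _ | ⟨a, l⟩
    · rfl
    · exact absurd (Subsingleton.elim a 1) (hl a List.mem_cons_self).1
  · have : IsLeftCancelMul M := ⟨fun _ _ _ _ => Subsingleton.elim _ _⟩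
    have : IsRightCancelMul M := ⟨fun _ _ _ _ => Subsingleton.elim _ _⟩
    exact {}

end Main

end Garside

theorem mainTheorem3 :
    (REPred fun P : Garside.GroupPresentation => Garside.IsGarsideGroup P.toGroup) ∧
    (REPred fun P : Garside.MonoidPresentation => Garside.IsGarsideMonoid P.toMonoid) ∧
    (∃ f : ℕ → Garside.GroupPresentation, Computable f ∧
      Set.range f = {P | Garside.IsGarsideGroup P.toGroup} ∧
      ∀ (G : Type u) [Group G], Garside.IsGarsideGroup G →
        ∃ n, Nonempty (G ≃* (f n).toGroup)) ∧
    (∃ f : ℕ → Garside.MonoidPresentation, Computable f ∧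
      Set.range f = {P | Garside.IsGarsideMonoid P.toMonoid} ∧
      ∀ (M : Type u) [Monoid M], Garside.IsGarsideMonoid M →
        ∃ n, Nonempty (M ≃* (f n).toMonoid)) := by
  -- The trivial monoid makes both sets nonempty, as the enumeration requires.
  obtain ⟨c, hc, -⟩ := (Garside.isGarsideMonoid_of_subsingleton Unit).exists_cert
  have hgroup : ∀ {c : Garside.GermCert} (hc : c.IsGood),
      Garside.IsGarsideGroup hc.presentation.groupPresentation.toGroup := fun hc =>
    hc.presentation.isGarsideGroup_of_mulEquiv hc.isGarsideMonoid_presentation (MulEquiv.refl _)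
  refine ⟨Garside.sigmaOne_isGarsideGroup.rePred, Garside.sigmaOne_isGarsideMonoid.rePred, ?_, ?_⟩
  · obtain ⟨f, hf, hrange⟩ :=
      Garside.sigmaOne_isGarsideGroup.exists_computable_range ⟨_, hgroup hc⟩
    refine ⟨f, hf, hrange, fun G _ hG => ?_⟩
    obtain ⟨c, hc, ⟨φ⟩⟩ := hG.exists_cert
    -- The presentation found for `G` itself presents a Garside group, so it occurs in the list.
    obtain ⟨n, hn⟩ : hc.presentation.groupPresentation ∈ Set.range f := by
      rw [hrange]
      exact hgroup hc
    exact ⟨n, by rw [hn]; exact ⟨φ.symm⟩⟩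
  · obtain ⟨f, hf, hrange⟩ := Garside.sigmaOne_isGarsideMonoid.exists_computable_range
      ⟨_, hc.isGarsideMonoid_presentation⟩
    refine ⟨f, hf, hrange, fun M _ hM => ?_⟩
    obtain ⟨c, hc, ⟨ψ⟩⟩ := hM.exists_cert
    obtain ⟨φ⟩ := hc.presentation.nonempty_mulEquiv_raw
    obtain ⟨n, hn⟩ : hc.presentation ∈ Set.range f := by
      rw [hrange]
      exact hc.isGarsideMonoid_presentation
    exact ⟨n, by rw [hn]; exact ⟨ψ.symm.trans φ.symm⟩⟩
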